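/- For $\kappa>0$ and a profile $h\colon[0,\pi]\to\mathbb{R}$ let $$E_\kappa(h)=\frac12\int_0^\pi \Big( h'^2\sin\theta+\frac{\sin^2 h}{\sin\theta}+\kappa\sin^2(h-\theta)\sin\theta\Big)\,d\theta$$ be the reduced energy, that is, $E_\kappa(h)=\frac1{2\pi}\mathcal{E}_\kappa(m)$ for the axisymmetric map $m(\theta,\varphi)=(\cos\varphi\sin h(\theta),\,\sin\varphi\sin h(\theta),\,\cos h(\theta))$ from $\mathbb{S}^2$ to $\mathbb{S}^2$ and $\mathcal{E}_\kappa(m)=\frac12\int_{\mathbb{S}^2}|\nabla m|^2+\kappa(1-\langle m,\nu\rangle^2)\,d\sigma$, where $\nu$ is the outer unit normal. Let $\delta^2E_\kappa[h](g)=\frac{d^2}{d\varepsilon^2}E_\kappa(h+\varepsilon g)\big|_{\varepsilon=0}$ be its second variation at $h$ in direction $g$. For $\kappa\ge4$ put $\theta_0=\frac{\pi}{2}-\frac{\pi}{2\sqrt{\kappa}}$ and let $h_{0,\kappa}$ be the continuous, piecewise affine profile with $$h_{0,\kappa}(\theta)=\begin{cases}\pi+\theta, & 0\le\theta\le\theta_0,\\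 \pi-\dfrac{\theta_0}{\pi/2-\theta_0}\,\big(\theta-\tfrac{\pi}{2}\big), & \theta_0<\theta\le\pi-\theta_0,\\ \theta, & \pi-\theta_0<\theta\le\pi.\end{cases}$$ Consider a global solution $u=u(t,\theta)$ of the axisymmetric skyrmionic map heat flow $$u_t=u_{\theta\theta}+\frac{\cos\theta}{\sin\theta}\,u_\theta-\frac{\sin 2u}{2\sin^2\theta}-\frac{\kappa}{2}\sin(2u-2\theta)\quad\text{on }(0,\infty)\times(0,\pi),$$ $$u(0,\cdot)=h_{0,\kappa},\qquad u(t,0)=u(t,\pi)=\pi\quad\text{for } t>0,$$ where $u$ is smooth on $(0,\infty)\times[0,\pi]$, continuous on $[0,\infty)\times[0,\pi]$, and the axisymmetric maps with profiles $u(t,\cdot)$ converge in $H^1(\mathbb{S}^2,\mathbb{R}^3)$ to the one with profile $h_{0,\kappa}$ as $t\downarrow0$. A smooth function $h_\kappa\colon[0,\pi]\to\mathbb{R}$ is called a profile of first type for $\kappa$ if $u(t_j,\cdot)\to h_\kappa$ uniformly on $[0,\pi]$ for such a solution $u$ and some sequence $t_j\to\infty$. Proposition. There exists $\kappa_0\ge4$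 such that for every $\kappa\ge\kappa_0$ and every profile $h_\kappa$ of first type for $\kappa$, the function $g_\kappa(\theta)=(h_\kappa'(\theta)-1)\sin\theta$ satisfies $$\delta^2E_\kappa[h_\kappa](g_\kappa)<0.$$ -/

import Mathlib

open scoped ContDiff

namespace SkyrmionSphere

noncomputable section

/-- The reduced energy
`E_κ(h) = 1/2 ∫_0^π (h'² sin θ + sin² h / sin θ + κ sin²(h - θ) sin θ) dθ`
of a profile `h` on `[0, π]`.  (Only the values of `h` on `[0, π]` matter.) -/
def reducedEnergy (κ : ℝ) (h : ℝ → ℝ) : ℝ :=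
  (1 / 2) * ∫ θ in (0 : ℝ)..Real.pi,
    (deriv h θ ^ 2 * Real.sin θ + Real.sin (h θ) ^ 2 / Real.sin θ
      + κ * Real.sin (h θ - θ) ^ 2 * Real.sin θ)

/-- The second variation `δ²E_κ[h](g) = d²/dε² E_κ(h + ε g)` at `ε = 0`. -/
def secondVariation (κ : ℝ) (h g : ℝ → ℝ) : ℝ :=
  iteratedDeriv 2 (fun ε : ℝ => reducedEnergy κ (fun θ => h θ + ε * g θ)) 0

/-- The direction `g(θ) = (h'(θ) - 1) sin θ`. -/
def shiftDirection (h : ℝ → ℝ) : ℝ → ℝ :=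
  fun θ => (deriv h θ - 1) * Real.sin θ

/-- The squared `H¹(𝕊²; ℝ³)`-distance of the two axisymmetric maps
`m_i(θ, φ) = (cos φ sin h_i(θ), sin φ sin h_i(θ), cos h_i(θ))`, `i = 1, 2`, written in spherical
coordinates: the integrand collects `|m₁ - m₂|²`, `|∂_θ (m₁ - m₂)|²` and
`|∂_φ (m₁ - m₂)|² / sin² θ`, each against the surface element `sin θ dθ dφ`. -/
def axisymmetricH1DistSq (h₁ h₂ : ℝ → ℝ) : ℝ :=
  2 * Real.pi * ∫ θ in (0 : ℝ)..Real.pi,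
    (((Real.sin (h₁ θ) - Real.sin (h₂ θ)) ^ 2 + (Real.cos (h₁ θ) - Real.cos (h₂ θ)) ^ 2)
        * Real.sin θ
      + ((deriv (fun x => Real.sin (h₁ x)) θ - deriv (fun x => Real.sin (h₂ x)) θ) ^ 2
          + (deriv (fun x => Real.cos (h₁ x)) θ - deriv (fun x => Real.cos (h₂ x)) θ) ^ 2)
        * Real.sin θ
      + (Real.sin (h₁ θ) - Real.sin (h₂ θ)) ^ 2 / Real.sin θ)

/-- `u t θ` is a global solution, without blowup at any finite time, of the skyrmionic map heat
flow for axisymmetric maps with initial profile `h₀`: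
`u_t = u_θθ + (cos θ / sin θ) u_θ - sin 2u / (2 sin² θ) - (κ / 2) sin (2u - 2θ)`. -/
structure IsProfileFlow (κ : ℝ) (h₀ : ℝ → ℝ) (u : ℝ → ℝ → ℝ) : Prop where
  /-- `u` is smooth on `(0, ∞) × [0, π]`, up to the poles `θ = 0` and `θ = π`. -/
  smooth : ContDiffOn ℝ ∞ (fun p : ℝ × ℝ => u p.1 p.2) (Set.Ioi 0 ×ˢ Set.Icc 0 Real.pi)
  /-- `u` is continuous down to the initial time. -/
  continuousOn : ContinuousOn (fun p : ℝ × ℝ => u p.1 p.2) (Set.Ici 0 ×ˢ Set.Icc 0 Real.pi)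
  equation : ∀ t : ℝ, 0 < t → ∀ θ ∈ Set.Ioo 0 Real.pi,
    deriv (fun s => u s θ) t
      = iteratedDeriv 2 (u t) θ + Real.cos θ / Real.sin θ * deriv (u t) θ
        - Real.sin (2 * u t θ) / (2 * Real.sin θ ^ 2)
        - κ / 2 * Real.sin (2 * u t θ - 2 * θ)
  initial : ∀ θ ∈ Set.Icc 0 Real.pi, u 0 θ = h₀ θ
  boundary_zero : ∀ t : ℝ, 0 < t → u t 0 = h₀ 0
  boundary_pi : ∀ t : ℝ, 0 < t → u t Real.pi = h₀ Real.pi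
  /-- The initial map is attained continuously in `H¹`. -/
  initial_H1 : Filter.Tendsto (fun t => axisymmetricH1DistSq (u t) h₀)
    (nhdsWithin 0 (Set.Ioi 0)) (nhds 0)

/-- The angle `θ₀(κ) = π/2 - π / (2 √κ)`. -/
def kinkAngle (κ : ℝ) : ℝ :=
  Real.pi / 2 - Real.pi / (2 * Real.sqrt κ)

/-- The initial profile `h_{0,κ}`: the line `π + θ` near `0`, the line `θ` near `π`, and the affine
interpolation in between, which passes through `(π/2, π)`. -/
def initialProfile (κ : ℝ) : ℝ → ℝ := fun θ =>
  if θ ≤ kinkAngle κ then Real.pi + θ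
  else if θ ≤ Real.pi - kinkAngle κ then
    Real.pi - kinkAngle κ / (Real.pi / 2 - kinkAngle κ) * (θ - Real.pi / 2)
  else θ

/-- `h` is a profile of first type for `κ`: a smooth function on `[0, π]` that is the limit, along
some sequence of times tending to infinity, of the flow that starts at `h_{0,κ}`. -/
def IsFirstTypeProfile (κ : ℝ) (h : ℝ → ℝ) : Prop :=
  ContDiffOn ℝ ∞ h (Set.Icc 0 Real.pi) ∧
    ∃ u : ℝ → ℝ → ℝ, IsProfileFlow κ (initialProfile κ) u ∧
      ∃ τ : ℕ → ℝ, Filter.Tendsto τ Filter.atTop Filter.atTop ∧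
        TendstoUniformlyOn (fun j => u (τ j)) h Filter.atTop (Set.Icc 0 Real.pi)

end

end SkyrmionSphere

/-!
The reasons for the sign are conformal. The field `sin θ ∂_θ` preserves the Dirichlet energy, so the
linearised operator at a stationary profile `h` sends `g = (h' - 1) sin θ`, which is the derivative
of `f = h - θ` along this field, to an expression without derivatives of `h`. Integration by parts
(`secondVariation_eq_integral_shiftDensity`) gives
`δ²E_κ[h](g) = -∫ f' sin θ (cos 2h - cos 2θ + κ sin θ cos θ sin 2f) dθ`.

The flow keeps the reflection symmetry `u(t, θ) + u(t, π - θ) = 2π` of its initial profile and, on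
the northern hemisphere, stays above the subsolution `π` and below the solution `π + θ`
(`flow_comparison`, `IsProfileFlow.add_reflect`, `IsProfileFlow.mem_hemisphere`). Sequential limits
are stationary: the energy controls `∫∫ sin θ u_t²` on compact subintervals
(`IsProfileFlow.exists_dissipation_bound`), so that the weak form of the equation passes to the
limit (`IsProfileFlow.tension_limit_eq_zero`).

It remains to study a stationary profile with `π ≤ h ≤ π + θ` on `[0, π/2]` and `h(π/2) = π`. Put
`q = π + θ - h = π - f`, so that `0 ≤ q ≤ θ`. In the variable `log tan (θ/2)` the function `q` is
convex, hence nondecreasing, and a first integral bounds its slope by `√(κ + 2π)`. The density above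
equals `-2 q' sin θ sin q ((κ - 2) sin θ cos θ cos q + cos 2θ sin q)`. It is nonpositive on
`[0, π/4]`. On `[π/4, π/2]` the second term contributes at most a constant because `q` is monotone,
while the slope bound yields `cos q ≤ 5 √κ cos θ`, so that the first term is at most
`-c √κ ∫ q' sin q cos² q` for some `c > 0`; the last integral is bounded below, as `q` runs from at
most `π/4` to `π/2`. For large `κ` the first term wins
(`IsHemisphereProfile.integral_shiftDensity_neg`).

Profiles given on `[0, π]` only are replaced throughout by `C^n` extensions to the line
(`exists_contDiff_extension`), which changes no integral.
-/

namespace SkyrmionSphere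

open Real Set Filter Topology MeasureTheory intervalIntegral

/-! ### Extension of smooth profiles beyond the interval -/

/-- A `C^n` function on a compact interval extends to a `C^n` function on the line: extend its
derivative and integrate. -/
lemma exists_contDiff_extension {a b : ℝ} (hab : a < b) (n : ℕ) {f : ℝ → ℝ}
    (hf : ContDiffOn ℝ n f (Icc a b)) : ∃ F : ℝ → ℝ, ContDiff ℝ n F ∧ EqOn F f (Icc a b) := by
  induction n generalizing f with
  | zero =>
    refine ⟨IccExtend hab.le ((Icc a b).domRestrict f), ?_, ?_⟩
    · have : Continuous (IccExtend hab.le ((Icc a b).domRestrict f)) :=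
        (continuousOn_iff_continuous_domRestrict.1 hf.continuousOn).Icc_extend'
      exact contDiff_zero.2 this
    · intro x hx
      rw [IccExtend_of_mem _ _ hx]; rfl
  | succ n ih =>
    have hu : UniqueDiffOn ℝ (Icc a b) := uniqueDiffOn_Icc hab
    push_cast at hf
    have h1 := (contDiffOn_succ_iff_derivWithin hu).1 hf
    obtain ⟨G, hG, hGf⟩ := ih h1.2.2
    have hd : ∀ x, HasDerivAt (fun x => f a + ∫ y in a..x, G y) (G x) x := fun x =>
      (integral_hasDerivAt_right (hG.continuous.intervalIntegrable _ _)
        hG.continuous.aestronglyMeasurable.stronglyMeasurableAtFilter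
        hG.continuous.continuousAt).const_add _
    refine ⟨fun x => f a + ∫ y in a..x, G y, ?_, ?_⟩
    · push_cast
      refine contDiff_succ_iff_deriv.2 ⟨fun x => (hd x).differentiableAt, by simp, ?_⟩
      rwa [show deriv (fun x => f a + ∫ y in a..x, G y) = G from funext fun x => (hd x).deriv]
    · intro x hx
      have hsub : Icc a x ⊆ Icc a b := Icc_subset_Icc_right hx.2
      have : ∫ y in a..x, G y = f x - f a := by
        refine integral_eq_sub_of_hasDerivAt_of_le hx.1 (h1.1.continuousOn.mono hsub) ?_
          (hG.continuous.intervalIntegrable _ _)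
        intro y hy
        have hy' : y ∈ Icc a b := hsub (Ioo_subset_Icc_self hy)
        have := (h1.1 y hy').hasDerivWithinAt
        rw [hGf hy']
        exact this.hasDerivAt (Icc_mem_nhds hy.1 (hy.2.trans_le hx.2))
      simp [this]

/-! ### Profiles with the value `π` at both poles -/

lemma sin_pos_of_mem {θ : ℝ} (h : θ ∈ Ioo 0 π) : 0 < sin θ := sin_pos_of_mem_Ioo h

/-- The sine of a `C¹` profile with the value `π` at both poles is at most a multiple of `sin θ`,
which compensates the singular weight `1 / sin θ` in the energy. -/
lemma exists_abs_sin_le {F : ℝ → ℝ} (hF : ContDiff ℝ 1 F) (h0 : F 0 = π) (hπ : F π = π) :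
    ∃ C, 0 ≤ C ∧ ∀ θ ∈ Icc 0 π, |sin (F θ)| ≤ C * sin θ := by
  obtain ⟨C, hC⟩ := (isCompact_Icc (a := (0 : ℝ)) (b := π)).exists_bound_of_continuousOn
    (hF.continuous_deriv le_rfl).continuousOn
  have hC0 : 0 ≤ C := (norm_nonneg _).trans (hC 0 ⟨le_rfl, pi_pos.le⟩)
  have lip : ∀ x ∈ Icc 0 π, ∀ y ∈ Icc 0 π, |F y - F x| ≤ C * |y - x| := fun x hx y hy =>
    Convex.norm_image_sub_le_of_norm_deriv_le (fun z _ => (hF.differentiable one_ne_zero) z)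
      hC (convex_Icc 0 π) hx hy
  have key : ∀ θ ∈ Icc 0 π, |sin (F θ)| ≤ |F θ - π| := fun θ _ => by
    rw [show sin (F θ) = -sin (F θ - π) by rw [sin_sub_pi]; ring, abs_neg]
    exact abs_sin_le_abs
  have hm0 : (0 : ℝ) ∈ Icc 0 π := ⟨le_rfl, pi_pos.le⟩
  have hmπ : π ∈ Icc 0 π := ⟨pi_pos.le, le_rfl⟩
  have aux : ∀ x y : ℝ, 0 ≤ y → y ≤ π / 2 → x ≤ C * y → x ≤ C * (π / 2) * sin y := by
    intro x y h1 h2 h3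
    have := mul_le_sin h1 h2
    have h4 : y ≤ π / 2 * sin y := by
      calc y = π / 2 * (2 / π * y) := by field_simp
        _ ≤ _ := by gcongr
    calc x ≤ C * y := h3
      _ ≤ C * (π / 2 * sin y) := by gcongr
      _ = _ := by ring
  refine ⟨C * (π / 2), by positivity, fun θ hθ => (key θ hθ).trans ?_⟩
  rcases le_total θ (π / 2) with h | h
  · refine aux _ _ hθ.1 h ?_
    have := lip 0 hm0 θ hθ
    rwa [h0, sub_zero, abs_of_nonneg hθ.1] at this
  · rw [← sin_pi_sub]
    refine aux _ _ (by linarith [hθ.2]) (by linarith) ?_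
    have := lip π hmπ θ hθ
    rwa [hπ, abs_sub_comm θ, abs_of_nonneg (by linarith [hθ.2] : 0 ≤ π - θ)] at this

/-- The singular part `sin² F / sin θ` of the energy density is integrable. -/
lemma intervalIntegrable_sin_sq_div {F : ℝ → ℝ} (hF : ContDiff ℝ 1 F) (h0 : F 0 = π)
    (hπ : F π = π) : IntervalIntegrable (fun θ => sin (F θ) ^ 2 / sin θ) volume 0 π := by
  obtain ⟨C, hC0, hC⟩ := exists_abs_sin_le hF h0 hπ
  rw [intervalIntegrable_iff_integrableOn_Ioo_of_le pi_pos.le]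
  refine Measure.integrableOn_of_bounded (M := C ^ 2) (by simp) ?_ ?_
  · exact (((measurable_sin.comp hF.continuous.measurable).pow_const 2).div
      measurable_sin).aestronglyMeasurable
  · refine (ae_restrict_iff' measurableSet_Ioo).2 (Eventually.of_forall fun θ hθ => ?_)
    have hs := sin_pos_of_mem hθ
    have h1 := hC θ (Ioo_subset_Icc_self hθ)
    rw [norm_eq_abs, abs_of_nonneg (by positivity), div_le_iff₀ hs, ← sq_abs]
    calc |sin (F θ)| ^ 2 ≤ (C * sin θ) ^ 2 := by gcongr
      _ = C ^ 2 * (sin θ * sin θ) := by ring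
      _ ≤ C ^ 2 * (sin θ * 1) := by gcongr; exact sin_le_one θ
      _ = _ := by ring

/-! ### The second variation -/

/-- The energy only depends on the profile inside the interval. -/
lemma reducedEnergy_congr (κ : ℝ) {h₁ h₂ : ℝ → ℝ} (h : EqOn h₁ h₂ (Ioo 0 π)) :
    reducedEnergy κ h₁ = reducedEnergy κ h₂ := by
  unfold reducedEnergy
  congr 1
  rw [integral_of_le pi_pos.le, integral_of_le pi_pos.le, integral_Ioc_eq_integral_Ioo,
    integral_Ioc_eq_integral_Ioo]
  refine setIntegral_congr_fun measurableSet_Ioo fun θ hθ => ?_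
  have : h₁ =ᶠ[𝓝 θ] h₂ := h.eventuallyEq_of_mem (Ioo_mem_nhds hθ.1 hθ.2)
  simp only [this.deriv_eq, h hθ]

lemma secondVariation_congr (κ : ℝ) {h₁ h₂ : ℝ → ℝ} (h : EqOn h₁ h₂ (Ioo 0 π)) :
    secondVariation κ h₁ (shiftDirection h₁) = secondVariation κ h₂ (shiftDirection h₂) := by
  unfold secondVariation
  congr 1
  funext ε
  refine reducedEnergy_congr κ fun θ hθ => ?_
  have : h₁ =ᶠ[𝓝 θ] h₂ := h.eventuallyEq_of_mem (Ioo_mem_nhds hθ.1 hθ.2)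
  simp only [shiftDirection, this.deriv_eq, h hθ]

/-- Differentiation under the integral sign for a jointly continuous derivative; the integrand
itself need only be integrable. -/
lemma hasDerivAt_integral_of_continuous_deriv {a b : ℝ} (hab : a ≤ b) {e e' : ℝ → ℝ → ℝ}
    (hint : ∀ ε, IntervalIntegrable (e ε) volume a b)
    (hcont : Continuous (fun p : ℝ × ℝ => e' p.1 p.2))
    (hd : ∀ θ ∈ Ioo a b, ∀ ε, HasDerivAt (fun ε => e ε θ) (e' ε θ) ε) (ε₀ : ℝ) :
    HasDerivAt (fun ε => ∫ θ in a..b, e ε θ) (∫ θ in a..b, e' ε₀ θ) ε₀ := by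
  obtain ⟨C, hC⟩ := ((isCompact_Icc (a := ε₀ - 1) (b := ε₀ + 1)).prod
    (isCompact_Icc (a := a) (b := b))).exists_bound_of_continuousOn hcont.continuousOn
  have hne : ∀ᵐ θ : ℝ, θ ≠ b := by simp [ae_iff]
  have hmem : ∀ᵐ θ : ℝ, θ ∈ uIoc a b → θ ∈ Ioo a b := by
    filter_upwards [hne] with θ h1 h2
    rw [uIoc_of_le hab] at h2
    exact ⟨h2.1, lt_of_le_of_ne h2.2 h1⟩
  refine (hasDerivAt_integral_of_dominated_loc_of_deriv_le (bound := fun _ => C)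
    (Icc_mem_nhds (by linarith : ε₀ - 1 < ε₀) (by linarith : ε₀ < ε₀ + 1)) ?_ (hint ε₀) ?_ ?_
    intervalIntegrable_const ?_).2
  · exact Eventually.of_forall fun ε => by
      rw [uIoc_of_le hab]; exact (hint ε).aestronglyMeasurable
  · exact (hcont.comp (by fun_prop : Continuous fun θ : ℝ => (ε₀, θ))).aestronglyMeasurable
  · filter_upwards [hmem] with θ h1 h2 ε hε
    exact hC (ε, θ) ⟨hε, Ioo_subset_Icc_self (h1 h2)⟩
  · filter_upwards [hmem] with θ h1 h2 ε hε
    exact hd θ (h1 h2) ε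

/-- The second variation as an integral, in a direction `G = P sin θ` that vanishes at the
poles. -/
lemma secondVariation_eq_integral (κ : ℝ) {H G P : ℝ → ℝ} (hH : ContDiff ℝ 1 H)
    (hG : ContDiff ℝ 1 G) (hP : Continuous P) (hGP : ∀ θ, G θ = P θ * sin θ) (h0 : H 0 = π)
    (hπ : H π = π) :
    secondVariation κ H G = ∫ θ in (0 : ℝ)..π, (deriv G θ ^ 2 * sin θ
      + cos (2 * H θ) * P θ ^ 2 * sin θ + κ * cos (2 * (H θ - θ)) * G θ ^ 2 * sin θ) := by
  have hH' : Continuous (deriv H) := hH.continuous_deriv le_rfl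
  have hG' : Continuous (deriv G) := hG.continuous_deriv le_rfl
  have cH := hH.continuous
  have cG := hG.continuous
  have dH : Differentiable ℝ H := hH.differentiable one_ne_zero
  have dG : Differentiable ℝ G := hG.differentiable one_ne_zero
  have hE : (fun ε : ℝ => reducedEnergy κ (fun θ => H θ + ε * G θ)) = fun ε =>
      (1 / 2) * ∫ θ in (0 : ℝ)..π, ((deriv H θ + ε * deriv G θ) ^ 2 * sin θ
        + sin (H θ + ε * G θ) ^ 2 / sin θ + κ * sin (H θ + ε * G θ - θ) ^ 2 * sin θ) := by
    funext ε
    unfold reducedEnergy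
    congr 1
    refine integral_congr fun θ _ => ?_
    have : deriv (fun θ => H θ + ε * G θ) θ = deriv H θ + ε * deriv G θ :=
      ((dH θ).hasDerivAt.add ((dG θ).hasDerivAt.const_mul ε)).deriv
    simp only [this]
  have h1 : ∀ ε₀, HasDerivAt (fun ε : ℝ => reducedEnergy κ (fun θ => H θ + ε * G θ))
      (∫ θ in (0 : ℝ)..π, ((deriv H θ + ε₀ * deriv G θ) * deriv G θ * sin θ
        + sin (H θ + ε₀ * G θ) * cos (H θ + ε₀ * G θ) * P θ
        + κ * (sin (H θ + ε₀ * G θ - θ) * cos (H θ + ε₀ * G θ - θ)) * G θ * sin θ)) ε₀ := by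
    intro ε₀
    rw [hE]
    have key := (hasDerivAt_integral_of_continuous_deriv pi_pos.le
      (e := fun ε θ => (deriv H θ + ε * deriv G θ) ^ 2 * sin θ
        + sin (H θ + ε * G θ) ^ 2 / sin θ + κ * sin (H θ + ε * G θ - θ) ^ 2 * sin θ)
      (e' := fun ε θ => 2 * ((deriv H θ + ε * deriv G θ) * deriv G θ * sin θ
        + sin (H θ + ε * G θ) * cos (H θ + ε * G θ) * P θ
        + κ * (sin (H θ + ε * G θ - θ) * cos (H θ + ε * G θ - θ)) * G θ * sin θ))
      ?_ (by fun_prop) ?_ ε₀).const_mul (1 / 2)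
    · refine key.congr_deriv ?_
      rw [intervalIntegral.integral_const_mul]; ring
    · intro ε
      have c1 : Continuous fun θ => (deriv H θ + ε * deriv G θ) ^ 2 * sin θ := by fun_prop
      have c2 : Continuous fun θ => κ * sin (H θ + ε * G θ - θ) ^ 2 * sin θ := by fun_prop
      refine ((c1.intervalIntegrable _ _).add (intervalIntegrable_sin_sq_div
        (F := fun θ => H θ + ε * G θ) (by fun_prop) ?_ ?_)).add (c2.intervalIntegrable _ _)
      · simp [h0, hGP]
      · simp [hπ, hGP]
    · intro θ hθ ε
      have hs := (sin_pos_of_mem hθ).ne'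
      have d1 : HasDerivAt (fun ε : ℝ => deriv H θ + ε * deriv G θ) (deriv G θ) ε := by
        simpa using ((hasDerivAt_id ε).mul_const (deriv G θ)).const_add (deriv H θ)
      have d2 : HasDerivAt (fun ε : ℝ => H θ + ε * G θ) (G θ) ε := by
        simpa using ((hasDerivAt_id ε).mul_const (G θ)).const_add (H θ)
      have := (((d1.pow 2).mul_const (sin θ)).add ((d2.sin.pow 2).div_const (sin θ))).add
        ((((d2.sub_const θ).sin.pow 2).const_mul κ).mul_const (sin θ))
      refine this.congr_deriv ?_
      rw [hGP θ]
      field_simp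
      ring
  have h2 : HasDerivAt (fun ε : ℝ => ∫ θ in (0 : ℝ)..π,
        ((deriv H θ + ε * deriv G θ) * deriv G θ * sin θ
        + sin (H θ + ε * G θ) * cos (H θ + ε * G θ) * P θ
        + κ * (sin (H θ + ε * G θ - θ) * cos (H θ + ε * G θ - θ)) * G θ * sin θ))
      (∫ θ in (0 : ℝ)..π, (deriv G θ ^ 2 * sin θ
        + cos (2 * (H θ + 0 * G θ)) * P θ ^ 2 * sin θ
        + κ * cos (2 * (H θ + 0 * G θ - θ)) * G θ ^ 2 * sin θ)) 0 := by
    refine hasDerivAt_integral_of_continuous_deriv pi_pos.le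
      (e' := fun ε θ => deriv G θ ^ 2 * sin θ
        + cos (2 * (H θ + ε * G θ)) * P θ ^ 2 * sin θ
        + κ * cos (2 * (H θ + ε * G θ - θ)) * G θ ^ 2 * sin θ) ?_ (by fun_prop) ?_ 0
    · intro ε
      refine Continuous.intervalIntegrable ?_ _ _
      fun_prop
    · intro θ hθ ε
      have d1 : HasDerivAt (fun ε : ℝ => deriv H θ + ε * deriv G θ) (deriv G θ) ε := by
        simpa using ((hasDerivAt_id ε).mul_const (deriv G θ)).const_add (deriv H θ)
      have d2 : HasDerivAt (fun ε : ℝ => H θ + ε * G θ) (G θ) ε := by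
        simpa using ((hasDerivAt_id ε).mul_const (G θ)).const_add (H θ)
      have d3 := d2.sub_const θ
      have := (((d1.mul_const (deriv G θ)).mul_const (sin θ)).add
        ((d2.sin.mul d2.cos).mul_const (P θ))).add
        ((((d3.sin.mul d3.cos).const_mul κ).mul_const (G θ)).mul_const (sin θ))
      refine this.congr_deriv ?_
      rw [hGP θ, cos_two_mul', cos_two_mul']
      ring
  unfold secondVariation
  rw [show (2 : ℕ) = 1 + 1 from rfl, iteratedDeriv_succ, iteratedDeriv_one,
    show deriv (fun ε : ℝ => reducedEnergy κ (fun θ => H θ + ε * G θ)) = _ from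
      funext fun ε => (h1 ε).deriv, h2.deriv]
  simp

/-! ### Stationary profiles: reduction of the second variation -/

/-- The right-hand side of the profile flow, i.e. minus the `L²(sin θ dθ)`-gradient of the
energy. -/
noncomputable def tension (κ : ℝ) (F : ℝ → ℝ) (θ : ℝ) : ℝ :=
  deriv (deriv F) θ + cos θ / sin θ * deriv F θ - sin (2 * F θ) / (2 * sin θ ^ 2)
    - κ / 2 * sin (2 * F θ - 2 * θ)

/-- The integrand to which the equation reduces the second variation in the direction
`(H' - 1) sin θ`. -/
noncomputable def shiftDensity (κ : ℝ) (H : ℝ → ℝ) (θ : ℝ) : ℝ :=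
  -((deriv H θ - 1) * sin θ * (cos (2 * H θ) - cos (2 * θ)
    + κ * sin θ * cos θ * sin (2 * (H θ - θ))))

lemma sin_sq_mul_tension (κ : ℝ) (F : ℝ → ℝ) {θ : ℝ} (hθ : θ ∈ Ioo 0 π) :
    sin θ ^ 2 * tension κ F θ = sin θ ^ 2 * deriv (deriv F) θ + sin θ * cos θ * deriv F θ
      - sin (2 * F θ) / 2 - κ / 2 * sin θ ^ 2 * sin (2 * F θ - 2 * θ) := by
  have := (sin_pos_of_mem hθ).ne'
  unfold tension
  field_simp

/-- The conformal field `sin θ ∂_θ` leaves the Dirichlet energy invariant, so that the linearised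
operator sends `(H' - 1) sin θ` to a term without derivatives of `H`; integrating by parts leaves
`shiftDensity`. -/
lemma secondVariation_eq_integral_shiftDensity (κ : ℝ) {H : ℝ → ℝ} (hH : ContDiff ℝ 3 H)
    (h0 : H 0 = π) (hπ : H π = π) (hst : ∀ θ ∈ Ioo 0 π, tension κ H θ = 0) :
    secondVariation κ H (shiftDirection H) = ∫ θ in (0 : ℝ)..π, shiftDensity κ H θ := by
  have hH1 : ContDiff ℝ 2 (deriv H) := hH.deriv'
  have hH2 : ContDiff ℝ 1 (deriv (deriv H)) := hH1.deriv'
  have hG : ContDiff ℝ 2 (shiftDirection H) := by unfold shiftDirection; fun_prop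
  have cH := hH.continuous
  have cH1 := hH1.continuous
  have cH2 := hH2.continuous
  have cH3 : Continuous (deriv (deriv (deriv H))) := hH2.continuous_deriv le_rfl
  have dH : ∀ θ, HasDerivAt H (deriv H θ) θ := fun θ =>
    (hH.differentiable (by norm_num) θ).hasDerivAt
  have dH1 : ∀ θ, HasDerivAt (deriv H) (deriv (deriv H) θ) θ := fun θ =>
    (hH1.differentiable (by norm_num) θ).hasDerivAt
  have dH2 : ∀ θ, HasDerivAt (deriv (deriv H)) (deriv (deriv (deriv H)) θ) θ := fun θ =>
    (hH2.differentiable (by norm_num) θ).hasDerivAt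
  have dG : ∀ θ, HasDerivAt (shiftDirection H)
      (deriv (deriv H) θ * sin θ + (deriv H θ - 1) * cos θ) θ := fun θ =>
    ((dH1 θ).sub_const 1).mul (hasDerivAt_sin θ)
  have dGe : deriv (shiftDirection H) =
      fun θ => deriv (deriv H) θ * sin θ + (deriv H θ - 1) * cos θ := funext fun θ => (dG θ).deriv
  have dG1 : ∀ θ, HasDerivAt (deriv (shiftDirection H))
      (deriv (deriv (deriv H)) θ * sin θ + deriv (deriv H) θ * cos θ
        + (deriv (deriv H) θ * cos θ + (deriv H θ - 1) * -sin θ)) θ := fun θ => by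
    rw [dGe]
    exact ((dH2 θ).mul (hasDerivAt_sin θ)).add (((dH1 θ).sub_const 1).mul (hasDerivAt_cos θ))
  have dW : ∀ θ, HasDerivAt (fun θ => shiftDirection H θ * (sin θ * deriv (shiftDirection H) θ)) _
      θ := fun θ => (dG θ).mul ((hasDerivAt_sin θ).mul (dG1 θ))
  -- the differentiated equation, cleared of denominators
  have hode : ∀ θ ∈ Ioo 0 π, sin θ ^ 2 * deriv (deriv (deriv H)) θ
      + 3 * (sin θ * cos θ * deriv (deriv H) θ) + (cos θ ^ 2 - sin θ ^ 2) * deriv H θ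
      - cos (2 * H θ) * deriv H θ - κ * sin θ * cos θ * sin (2 * H θ - 2 * θ)
      - κ * sin θ ^ 2 * cos (2 * H θ - 2 * θ) * (deriv H θ - 1) = 0 := by
    intro θ hθ
    have h1 := (((((hasDerivAt_sin θ).pow 2).mul (dH2 θ)).add
      (((hasDerivAt_sin θ).mul (hasDerivAt_cos θ)).mul (dH1 θ))).sub
      (((dH θ).const_mul 2).sin.div_const 2)).sub
      ((((hasDerivAt_sin θ).pow 2).const_mul (κ / 2)).mul
        (((dH θ).const_mul 2).sub ((hasDerivAt_id θ).const_mul 2)).sin)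
    have h2 : HasDerivAt (fun _ : ℝ => (0 : ℝ)) 0 θ := hasDerivAt_const θ 0
    have h3 := h1.unique (h2.congr_of_eventuallyEq ?_)
    · simp only [Nat.cast_ofNat, Pi.pow_apply, Pi.mul_apply, Pi.sub_apply, id] at h3
      linear_combination h3
    · filter_upwards [Ioo_mem_nhds hθ.1 hθ.2] with x hx
      have := sin_sq_mul_tension κ H hx
      rw [hst x hx, mul_zero] at this
      simp only [Pi.pow_apply, Pi.mul_apply, Pi.sub_apply, Pi.add_apply, id]
      linear_combination -this
  rw [secondVariation_eq_integral κ (P := fun θ => deriv H θ - 1) (hH.of_le (by norm_num))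
    (hG.of_le (by norm_num)) (by fun_prop) (fun θ => rfl) h0 hπ]
  have hW : ∫ θ in (0 : ℝ)..π, _ = _ := integral_eq_sub_of_hasDerivAt (fun θ _ => dW θ) (by
    refine Continuous.intervalIntegrable ?_ _ _
    rw [dGe]; fun_prop)
  have hW0 : shiftDirection H π * (sin π * deriv (shiftDirection H) π)
      - shiftDirection H 0 * (sin 0 * deriv (shiftDirection H) 0) = 0 := by simp
  rw [hW0] at hW
  refine sub_eq_zero.1 ?_
  rw [← intervalIntegral.integral_sub]
  · refine Eq.trans ?_ hW
    rw [integral_of_le pi_pos.le, integral_of_le pi_pos.le, integral_Ioc_eq_integral_Ioo,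
      integral_Ioc_eq_integral_Ioo]
    refine setIntegral_congr_fun measurableSet_Ioo fun θ hθ => ?_
    have := hode θ hθ
    simp only [dGe, shiftDirection, shiftDensity, cos_two_mul', mul_sub 2 (H θ) θ] at this ⊢
    linear_combination (-(deriv H θ - 1) * sin θ) * this
  · refine Continuous.intervalIntegrable ?_ _ _
    rw [dGe]; unfold shiftDirection; fun_prop
  · refine Continuous.intervalIntegrable ?_ _ _
    unfold shiftDensity; fun_prop

/-- A profile that is odd about the point `(π/2, π)` has an even `shiftDensity`. -/
lemma integral_shiftDensity_eq_two_mul (κ : ℝ) {H : ℝ → ℝ} (hH : ContDiff ℝ 1 H)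
    (hsym : ∀ θ ∈ Icc 0 π, H θ + H (π - θ) = 2 * π) :
    ∫ θ in (0 : ℝ)..π, shiftDensity κ H θ = 2 * ∫ θ in (0 : ℝ)..(π / 2), shiftDensity κ H θ := by
  have cH := hH.continuous
  have cH1 := hH.continuous_deriv le_rfl
  have cI : Continuous (shiftDensity κ H) := by unfold shiftDensity; fun_prop
  have hev : ∀ θ ∈ Ioo 0 π, shiftDensity κ H (π - θ) = shiftDensity κ H θ := by
    intro θ hθ
    have hval : H (π - θ) = 2 * π - H θ := by linarith [hsym θ (Ioo_subset_Icc_self hθ)]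
    have hder : deriv H (π - θ) = deriv H θ := by
      have h1 : HasDerivAt (fun x => 2 * π - H (π - x)) (deriv H (π - θ)) θ := by
        have h2 : HasDerivAt (fun x => H (π - x)) (-deriv H (π - θ)) θ :=
          HasDerivAt.comp_const_sub π θ (hH.differentiable one_ne_zero (π - θ)).hasDerivAt
        simpa using h2.const_sub (2 * π)
      have h2 := (hH.differentiable one_ne_zero θ).hasDerivAt
      refine h1.unique (h2.congr_of_eventuallyEq ?_)
      filter_upwards [Ioo_mem_nhds hθ.1 hθ.2] with x hx
      linarith [hsym x (Ioo_subset_Icc_self hx)]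
    unfold shiftDensity
    rw [hval, hder, sin_pi_sub, cos_pi_sub,
      show 2 * (2 * π - H θ) = 2 * (2 * π) - 2 * H θ by ring,
      show 2 * (2 * π - H θ - (π - θ)) = 2 * π - 2 * (H θ - θ) by ring, sin_two_pi_sub,
      show 2 * (π - θ) = 2 * π - 2 * θ by ring, cos_two_pi_sub,
      show cos (2 * (2 * π) - 2 * H θ) = cos (2 * H θ) by
        rw [show 2 * (2 * π) - 2 * H θ = 2 * π - 2 * H θ + 2 * π by ring, cos_add_two_pi,
          cos_two_pi_sub]]
    ring
  have hhalf : ∫ θ in (π / 2)..π, shiftDensity κ H θ =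
      ∫ θ in (0 : ℝ)..(π / 2), shiftDensity κ H θ := by
    have h1 : ∫ θ in (0 : ℝ)..(π / 2), shiftDensity κ H (π - θ) =
        ∫ θ in (π / 2)..π, shiftDensity κ H θ := by
      rw [integral_comp_sub_left (fun x => shiftDensity κ H x) π]
      congr 1 <;> ring
    rw [← h1]
    refine integral_congr_Ioo_of_le (by positivity) fun θ hθ => hev θ ⟨hθ.1, ?_⟩
    linarith [hθ.2, pi_pos]
  rw [← integral_add_adjacent_intervals (cI.intervalIntegrable 0 (π / 2))
    (cI.intervalIntegrable (π / 2) π), hhalf]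
  ring

/-! ### Stationary profiles on the northern hemisphere -/

/-- On `[0, π/2]` the deviation `q = π + θ - H` from the outer line satisfies, with
`v = sin θ q'`, an equation whose right-hand side is nonnegative for `0 ≤ q ≤ π/2` and `κ ≥ 1`. -/
lemma sin_mul_deriv_eq {κ : ℝ} {H : ℝ → ℝ} {θ : ℝ} (hθ : θ ∈ Ioo 0 π)
    (hst : tension κ H θ = 0) :
    sin θ * (cos θ * (1 - deriv H θ) - sin θ * deriv (deriv H) θ) = sin (π + θ - H θ) *
      (2 * sin θ * cos θ * sin (π + θ - H θ)
        + (cos θ ^ 2 - sin θ ^ 2 + κ * sin θ ^ 2) * cos (π + θ - H θ)) := by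
  have h1 := sin_sq_mul_tension κ H hθ
  rw [hst, mul_zero] at h1
  set q := π + θ - H θ with hq
  have e1 : 2 * H θ = 2 * (θ - q) + 2 * π := by rw [hq]; ring
  have e2 : 2 * H θ - 2 * θ = 2 * π - 2 * q := by rw [hq]; ring
  clear_value q
  rw [e2, sin_two_pi_sub, e1, sin_add_two_pi, sin_two_mul, sin_two_mul, sin_sub, cos_sub] at h1
  have h2 := sin_sq_add_cos_sq q
  linear_combination h1 - (sin θ * cos θ) * h2

/-- A profile that is stationary on `(0, π)`, lies between `π` and `π + θ` on the northern
hemisphere `[0, π/2]`, and takes the value `π` at the equator. -/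
structure IsHemisphereProfile (κ : ℝ) (H : ℝ → ℝ) : Prop where
  contDiff : ContDiff ℝ 2 H
  stationary : ∀ θ ∈ Ioo 0 π, tension κ H θ = 0
  lower : ∀ θ ∈ Icc 0 (π / 2), π ≤ H θ
  upper : ∀ θ ∈ Icc 0 (π / 2), H θ ≤ π + θ
  mid : H (π / 2) = π

namespace IsHemisphereProfile

variable {κ : ℝ} {H : ℝ → ℝ}

lemma hasDerivAt (hH : IsHemisphereProfile κ H) (θ : ℝ) : HasDerivAt H (deriv H θ) θ :=
  (hH.contDiff.differentiable (by norm_num) θ).hasDerivAt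

lemma hasDerivAt_deriv (hH : IsHemisphereProfile κ H) (θ : ℝ) :
    HasDerivAt (deriv H) (deriv (deriv H) θ) θ :=
  ((hH.contDiff.deriv' : ContDiff ℝ 1 (deriv H)).differentiable (by norm_num) θ).hasDerivAt

lemma hasDerivAt_dev (hH : IsHemisphereProfile κ H) (θ : ℝ) :
    HasDerivAt (fun θ => π + θ - H θ) (1 - deriv H θ) θ :=
  ((hasDerivAt_id θ).const_add π).sub (hH.hasDerivAt θ)

lemma hasDerivAt_slope (hH : IsHemisphereProfile κ H) (θ : ℝ) :
    HasDerivAt (fun θ => sin θ * (1 - deriv H θ))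
      (cos θ * (1 - deriv H θ) - sin θ * deriv (deriv H) θ) θ := by
  refine ((hasDerivAt_sin θ).mul ((hH.hasDerivAt_deriv θ).const_sub 1)).congr_deriv ?_
  ring

lemma sin_dev_nonneg (hH : IsHemisphereProfile κ H) {θ : ℝ} (hθ : θ ∈ Icc 0 (π / 2)) :
    0 ≤ sin (π + θ - H θ) :=
  sin_nonneg_of_nonneg_of_le_pi (by linarith [hH.upper θ hθ])
    (by linarith [hH.lower θ hθ, hθ.2, pi_pos])

lemma cos_dev_nonneg (hH : IsHemisphereProfile κ H) {θ : ℝ} (hθ : θ ∈ Icc 0 (π / 2)) :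
    0 ≤ cos (π + θ - H θ) :=
  cos_nonneg_of_neg_pi_div_two_le_of_le (by linarith [hH.upper θ hθ, pi_pos])
    (by linarith [hH.lower θ hθ, hθ.2])

lemma sin_nonneg_of_mem_hemisphere {θ : ℝ} (hθ : θ ∈ Icc 0 (π / 2)) : 0 ≤ sin θ :=
  sin_nonneg_of_nonneg_of_le_pi hθ.1 (by linarith [hθ.2, pi_pos])

lemma cos_nonneg_of_mem_hemisphere {θ : ℝ} (hθ : θ ∈ Icc 0 (π / 2)) : 0 ≤ cos θ :=
  cos_nonneg_of_neg_pi_div_two_le_of_le (by linarith [hθ.1, pi_pos]) hθ.2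

/-- The deviation `q` is convex in the conformal variable `log tan (θ/2)`, hence nondecreasing. -/
lemma slope_nonneg (hH : IsHemisphereProfile κ H) (hκ : 1 ≤ κ) {θ : ℝ}
    (hθ : θ ∈ Icc 0 (π / 2)) : 0 ≤ sin θ * (1 - deriv H θ) := by
  have hm : MonotoneOn (fun θ => sin θ * (1 - deriv H θ)) (Icc 0 (π / 2)) := by
    refine monotoneOn_of_deriv_nonneg (convex_Icc _ _)
      (fun x _ => (hH.hasDerivAt_slope x).continuousAt.continuousWithinAt)
      (fun x _ => (hH.hasDerivAt_slope x).differentiableAt.differentiableWithinAt) ?_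
    intro x hx
    rw [interior_Icc] at hx
    have hx' := Ioo_subset_Icc_self hx
    have hxπ : x ∈ Ioo 0 π := ⟨hx.1, by linarith [hx.2, pi_pos]⟩
    rw [(hH.hasDerivAt_slope x).deriv]
    refine nonneg_of_mul_nonneg_right ?_ (sin_pos_of_mem hxπ)
    rw [sin_mul_deriv_eq hxπ (hH.stationary x hxπ)]
    have := hH.sin_dev_nonneg hx'
    have := hH.cos_dev_nonneg hx'
    have := sin_nonneg_of_mem_hemisphere hx'
    have := cos_nonneg_of_mem_hemisphere hx'
    have : 0 ≤ cos x ^ 2 - sin x ^ 2 + κ * sin x ^ 2 := by nlinarith [sq_nonneg (sin x)]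
    positivity
  have := hm ⟨le_rfl, by positivity⟩ hθ hθ.1
  simpa using this

/-- The first integral of the equation bounds the slope by `O(√κ)`. -/
lemma slope_sq_le (hH : IsHemisphereProfile κ H) (hκ : 1 ≤ κ) {θ : ℝ}
    (hθ : θ ∈ Icc 0 (π / 2)) : (sin θ * (1 - deriv H θ)) ^ 2 ≤ κ + 2 * π := by
  have hd : ∀ θ, HasDerivAt (fun θ => (sin θ * (1 - deriv H θ)) ^ 2
      - κ * sin (π + θ - H θ) ^ 2 - 4 * (π + θ - H θ)) _ θ := fun θ =>
    (((hH.hasDerivAt_slope θ).pow 2).sub (((hH.hasDerivAt_dev θ).sin.pow 2).const_mul κ)).sub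
      ((hH.hasDerivAt_dev θ).const_mul 4)
  have hm : AntitoneOn (fun θ => (sin θ * (1 - deriv H θ)) ^ 2
      - κ * sin (π + θ - H θ) ^ 2 - 4 * (π + θ - H θ)) (Icc 0 (π / 2)) := by
    refine antitoneOn_of_deriv_nonpos (convex_Icc _ _)
      (fun x _ => (hd x).continuousAt.continuousWithinAt)
      (fun x _ => (hd x).differentiableAt.differentiableWithinAt) ?_
    intro x hx
    rw [interior_Icc] at hx
    have hx' := Ioo_subset_Icc_self hx
    have hxπ : x ∈ Ioo 0 π := ⟨hx.1, by linarith [hx.2, pi_pos]⟩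
    have hs := sin_pos_of_mem hxπ
    have hq' : 0 ≤ 1 - deriv H x := nonneg_of_mul_nonneg_right (hH.slope_nonneg hκ hx') hs
    rw [(hd x).deriv]
    have key := sin_mul_deriv_eq hxπ (hH.stationary x hxπ)
    have hsq := hH.sin_dev_nonneg hx'
    have hcq := hH.cos_dev_nonneg hx'
    have hc := cos_nonneg_of_mem_hemisphere hx'
    set q := π + x - H x with hq
    have e : ∀ a : ℝ, (2 : ℕ) * (sin x * (1 - deriv H x)) ^ (2 - 1) * a
        - κ * ((2 : ℕ) * sin q ^ (2 - 1) * (cos q * (1 - deriv H x))) - 4 * (1 - deriv H x) =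
        (1 - deriv H x) * (2 * (sin x * a) - 2 * κ * sin q * cos q - 4) := by
      intro a; push_cast; ring
    rw [e, key]
    refine mul_nonpos_of_nonneg_of_nonpos hq' ?_
    have h1 := sin_sq_add_cos_sq x
    have h2 := sin_sq_add_cos_sq q
    have h3 : 2 * sin x * cos x ≤ 1 := by nlinarith [sq_nonneg (sin x - cos x)]
    have h4 : 2 * sin q * cos q ≤ 1 := by nlinarith [sq_nonneg (sin q - cos q)]
    have h5 : sin q ^ 2 ≤ 1 := by nlinarith [sq_nonneg (cos q)]
    have h6 : cos x ^ 2 ≤ 1 := by nlinarith [sq_nonneg (sin x)]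
    have h7 : 0 ≤ sin q * cos q := by positivity
    have h8 : 2 * sin x * cos x * sin q ^ 2 ≤ 1 := by
      calc 2 * sin x * cos x * sin q ^ 2 ≤ 1 * 1 := by gcongr
        _ = 1 := by norm_num
    have h9 : (κ - 1) * (sin q * cos q) * cos x ^ 2 ≥ 0 := by
      have : 0 ≤ κ - 1 := by linarith
      positivity
    have h10 : sin x ^ 2 = 1 - cos x ^ 2 := by linarith
    have h11 : sin q * (2 * sin x * cos x * sin q
        + (cos x ^ 2 - sin x ^ 2 + κ * sin x ^ 2) * cos q) - κ * sin q * cos q =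
        2 * sin x * cos x * sin q ^ 2 + (2 * cos x ^ 2 - 1) * (sin q * cos q)
          - κ * (sin q * cos q) * cos x ^ 2 := by rw [h10]; ring
    nlinarith
  have h0 : H 0 = π := le_antisymm (by simpa using hH.upper 0 ⟨le_rfl, by positivity⟩)
    (hH.lower 0 ⟨le_rfl, by positivity⟩)
  have h1 := hm ⟨le_rfl, by positivity⟩ hθ hθ.1
  simp only [sin_zero, h0] at h1
  have h2 : κ * sin (π + θ - H θ) ^ 2 ≤ κ * 1 := by
    gcongr; exact sin_sq_le_one _
  have h3 := hH.lower θ hθ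
  have h4 := hθ.2
  norm_num at h1
  linarith

lemma shiftDensity_eq (κ : ℝ) (H : ℝ → ℝ) (θ : ℝ) : shiftDensity κ H θ =
    -(2 * (1 - deriv H θ) * sin θ * sin (π + θ - H θ) *
      ((κ - 2) * sin θ * cos θ * cos (π + θ - H θ)
        + (cos θ ^ 2 - sin θ ^ 2) * sin (π + θ - H θ))) := by
  set q := π + θ - H θ with hq
  have e1 : 2 * H θ = 2 * (θ - q) + 2 * π := by rw [hq]; ring
  have e2 : 2 * (H θ - θ) = 2 * π - 2 * q := by rw [hq]; ring
  clear_value q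
  unfold shiftDensity
  rw [e2, sin_two_pi_sub, e1, cos_add_two_pi, cos_two_mul', cos_two_mul', sin_two_mul,
    cos_sub, sin_sub]
  have h1 := sin_sq_add_cos_sq q
  linear_combination -(deriv H θ - 1) * sin θ * (cos θ ^ 2 - sin θ ^ 2) * h1

/-- Away from the equator both terms of the density have the favourable sign. -/
lemma shiftDensity_nonpos (hH : IsHemisphereProfile κ H) (hκ : 2 ≤ κ) {θ : ℝ}
    (hθ : θ ∈ Ioc 0 (π / 4)) : shiftDensity κ H θ ≤ 0 := by
  have hθ' : θ ∈ Icc 0 (π / 2) := ⟨hθ.1.le, by linarith [hθ.2, pi_pos]⟩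
  have h1 := hH.slope_nonneg (by linarith) hθ'
  have h2 := hH.sin_dev_nonneg hθ'
  have h3 := hH.cos_dev_nonneg hθ'
  have h4 := sin_nonneg_of_mem_hemisphere hθ'
  have h5 := cos_nonneg_of_mem_hemisphere hθ'
  have h6 : 0 ≤ κ - 2 := by linarith
  have h7 : 0 ≤ cos θ ^ 2 - sin θ ^ 2 := by
    rw [← cos_two_mul']
    exact cos_nonneg_of_neg_pi_div_two_le_of_le (by linarith [hθ.1, pi_pos]) (by linarith [hθ.2])
  rw [shiftDensity_eq, neg_nonpos,
    show 2 * (1 - deriv H θ) * sin θ * sin (π + θ - H θ) =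
      2 * (sin θ * (1 - deriv H θ)) * sin (π + θ - H θ) by ring]
  positivity

/-- Near the equator the profile crosses at slope `O(√κ)`, so that `cos q` is at most `O(√κ)` times
the distance to the equator. -/
lemma cos_dev_le (hH : IsHemisphereProfile κ H) (hκ : 7 ≤ κ) {θ : ℝ}
    (hθ : θ ∈ Icc (π / 4) (π / 2)) : cos (π + θ - H θ) ≤ 5 * √κ * cos θ := by
  have hsub : ∀ x ∈ Icc (π / 4) (π / 2), x ∈ Icc 0 (π / 2) := fun x hx =>
    ⟨by linarith [hx.1, pi_pos], hx.2⟩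
  have hslope : ∀ x ∈ Icc (π / 4) (π / 2), 1 - deriv H x ≤ 3 * √κ := by
    intro x hx
    have h1 := hH.slope_sq_le (by linarith) (hsub x hx)
    have h2 : 1 / 2 ≤ sin x ^ 2 := by
      have : cos (2 * x) ≤ 0 := cos_nonpos_of_pi_div_two_le_of_le (by linarith [hx.1])
        (by linarith [hx.2, pi_pos])
      rw [cos_two_mul'] at this
      linarith [sin_sq_add_cos_sq x]
    have h3 : (1 - deriv H x) ^ 2 ≤ (3 * √κ) ^ 2 := by
      rw [mul_pow, sq_sqrt (by linarith)]
      rw [mul_pow] at h1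
      nlinarith [sq_nonneg (1 - deriv H x), pi_lt_d2]
    exact abs_le_of_sq_le_sq' h3 (by positivity) |>.2
  have hmv : π / 2 - (π + θ - H θ) ≤ 3 * √κ * (π / 2 - θ) := by
    have := Convex.image_sub_le_mul_sub_of_deriv_le (convex_Icc (π / 4) (π / 2))
      (f := fun θ => π + θ - H θ) (C := 3 * √κ)
      (fun x _ => (hH.hasDerivAt_dev x).continuousAt.continuousWithinAt)
      (fun x _ => (hH.hasDerivAt_dev x).differentiableAt.differentiableWithinAt)
      (fun x hx => by
        rw [(hH.hasDerivAt_dev x).deriv]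
        exact hslope x (interior_subset hx)) θ hθ (π / 2) ⟨by linarith [pi_pos], le_rfl⟩ hθ.2
    simpa [hH.mid] using this
  have h1 : cos (π + θ - H θ) ≤ π / 2 - (π + θ - H θ) := by
    rw [← sin_pi_div_two_sub]
    exact sin_le (by linarith [hH.lower θ (hsub θ hθ), hθ.2])
  have h2 : 2 / π * (π / 2 - θ) ≤ cos θ := by
    rw [← sin_pi_div_two_sub]
    exact mul_le_sin (by linarith [hθ.2]) (by linarith [hθ.1, pi_pos])
  have h3 : π / 2 - θ ≤ π / 2 * cos θ := by
    calc π / 2 - θ = π / 2 * (2 / π * (π / 2 - θ)) := by field_simp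
      _ ≤ _ := by gcongr
  have h4 := cos_nonneg_of_mem_hemisphere (hsub θ hθ)
  calc cos (π + θ - H θ) ≤ 3 * √κ * (π / 2 - θ) := h1.trans hmv
    _ ≤ 3 * √κ * (π / 2 * cos θ) := by gcongr
    _ = (3 * π / 2) * (√κ * cos θ) := by ring
    -- the constant `5` is an upper bound for `3π/2`
    _ ≤ 5 * (√κ * cos θ) := by gcongr; linarith [pi_lt_d2]
    _ = _ := by ring

/-- Near the equator the density is bounded by a total derivative in `q`. -/
lemma shiftDensity_le (hH : IsHemisphereProfile κ H) (hκ : 1000 ≤ √κ) {θ : ℝ}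
    (hθ : θ ∈ Icc (π / 4) (π / 2)) : shiftDensity κ H θ ≤
      (1 - deriv H θ) * (2 - √κ / 6 * sin (π + θ - H θ) * cos (π + θ - H θ) ^ 2) := by
  have hθ' : θ ∈ Icc 0 (π / 2) := ⟨by linarith [hθ.1, pi_pos], hθ.2⟩
  have hκ0 : 0 ≤ κ := by
    by_contra h
    rw [sqrt_eq_zero_of_nonpos (by linarith)] at hκ
    norm_num at hκ
  have hsq : √κ ^ 2 = κ := sq_sqrt hκ0
  have hκ1 : 1000000 ≤ κ := by nlinarith
  have hs : 0 < sin θ := sin_pos_of_mem ⟨by linarith [hθ.1, pi_pos], by linarith [hθ.2, pi_pos]⟩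
  have h1 : 0 ≤ 1 - deriv H θ :=
    nonneg_of_mul_nonneg_right (hH.slope_nonneg (by linarith) hθ') hs
  have h2 := hH.sin_dev_nonneg hθ'
  have h3 := hH.cos_dev_nonneg hθ'
  have h5 := cos_nonneg_of_mem_hemisphere hθ'
  have h6 := hH.cos_dev_le (by linarith) hθ
  have h7 : 1 / 2 ≤ sin θ ^ 2 := by
    have : cos (2 * θ) ≤ 0 := cos_nonpos_of_pi_div_two_le_of_le (by linarith [hθ.1])
      (by linarith [hθ.2, pi_pos])
    rw [cos_two_mul'] at this
    linarith [sin_sq_add_cos_sq θ]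
  rw [shiftDensity_eq]
  set q := π + θ - H θ with hq
  set r := √κ with hr
  have hsin1 : sin θ ≤ 1 := sin_le_one θ
  have hq1 : sin q ≤ 1 := sin_le_one q
  -- the unfavourable term
  have hA : sin θ * sin q * ((sin θ ^ 2 - cos θ ^ 2) * sin q) ≤ 1 := by
    have hd1 : sin θ ^ 2 - cos θ ^ 2 ≤ 1 := by nlinarith [sin_sq_le_one θ, sq_nonneg (cos θ)]
    have hd0 : 0 ≤ sin θ ^ 2 - cos θ ^ 2 := by linarith [sin_sq_add_cos_sq θ]
    generalize sin θ ^ 2 - cos θ ^ 2 = d at hd0 hd1 ⊢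
    calc sin θ * sin q * (d * sin q)
        ≤ 1 * 1 * (1 * 1) := by
          gcongr
      _ = 1 := by norm_num
  -- the favourable term
  have hB : r / 12 * sin q * cos q ^ 2 ≤ sin θ * sin q * ((κ - 2) * sin θ * cos θ * cos q) := by
    have hr0 : 0 < r := by linarith
    have hc : cos q / (5 * r) ≤ cos θ := by
      rw [div_le_iff₀ (by positivity)]; linarith
    have hk : r / 6 ≤ (κ - 2) / (5 * r) := by
      rw [div_le_div_iff₀ (by norm_num) (by positivity)]
      nlinarith
    have hk0 : 0 ≤ κ - 2 := by linarith
    calc r / 12 * sin q * cos q ^ 2 = 1 / 2 * (r / 6) * (sin q * cos q ^ 2) := by ring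
      _ ≤ sin θ ^ 2 * ((κ - 2) / (5 * r)) * (sin q * cos q ^ 2) := by gcongr
      _ = sin θ ^ 2 * (κ - 2) * sin q * cos q * (cos q / (5 * r)) := by ring
      _ ≤ sin θ ^ 2 * (κ - 2) * sin q * cos q * cos θ := by gcongr
      _ = _ := by ring
  calc _ = (1 - deriv H θ) * (2 * (sin θ * sin q * ((sin θ ^ 2 - cos θ ^ 2) * sin q))
        - 2 * (sin θ * sin q * ((κ - 2) * sin θ * cos θ * cos q))) := by ring
    _ ≤ (1 - deriv H θ) * (2 * 1 - 2 * (r / 12 * sin q * cos q ^ 2)) := by gcongr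
    _ = _ := by ring

/-- The favourable term is of order `√κ` and the unfavourable one bounded, hence the sign. The
threshold comes from `√κ / 18 * cos³ (q (π/4)) > π`, where `cos (q (π/4)) ≥ √2 / 2`. -/
lemma integral_shiftDensity_neg (hH : IsHemisphereProfile κ H) (hκ : 1000 ≤ √κ) :
    ∫ θ in (0 : ℝ)..(π / 2), shiftDensity κ H θ < 0 := by
  have cH := hH.contDiff.continuous
  have cH1 := hH.contDiff.continuous_deriv (by norm_num)
  have cI : Continuous (shiftDensity κ H) := by unfold shiftDensity; fun_prop
  have hκ2 : 2 ≤ κ := by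
    by_contra h
    have : √κ ≤ √4 := sqrt_le_sqrt (by linarith)
    rw [show (4 : ℝ) = 2 ^ 2 by norm_num, sqrt_sq (by norm_num)] at this
    linarith
  have h1 : ∫ θ in (0 : ℝ)..(π / 4), shiftDensity κ H θ ≤ 0 := by
    rw [integral_of_le (by positivity)]
    exact setIntegral_nonpos measurableSet_Ioc fun θ hθ => hH.shiftDensity_nonpos hκ2 hθ
  have hd : ∀ θ, HasDerivAt (fun θ => √κ / 18 * cos (π + θ - H θ) ^ 3 + 2 * (π + θ - H θ))
      ((1 - deriv H θ) * (2 - √κ / 6 * sin (π + θ - H θ) * cos (π + θ - H θ) ^ 2)) θ := fun θ => by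
    refine ((((hH.hasDerivAt_dev θ).cos.pow 3).const_mul (√κ / 18)).add
      ((hH.hasDerivAt_dev θ).const_mul 2)).congr_deriv ?_
    push_cast; ring
  have cB : Continuous fun θ =>
      (1 - deriv H θ) * (2 - √κ / 6 * sin (π + θ - H θ) * cos (π + θ - H θ) ^ 2) := by fun_prop
  have hle : π / 4 ≤ π / 2 := by linarith [pi_pos]
  have h2 : ∫ θ in (π / 4)..(π / 2), shiftDensity κ H θ ≤
      √κ / 18 * cos (π + π / 2 - H (π / 2)) ^ 3 + 2 * (π + π / 2 - H (π / 2)) -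
      (√κ / 18 * cos (π + π / 4 - H (π / 4)) ^ 3 + 2 * (π + π / 4 - H (π / 4))) := by
    rw [← integral_eq_sub_of_hasDerivAt (fun θ _ => hd θ) (cB.intervalIntegrable _ _)]
    exact integral_mono_on hle (cI.intervalIntegrable _ _) (cB.intervalIntegrable _ _)
      fun θ hθ => hH.shiftDensity_le hκ hθ
  rw [← integral_add_adjacent_intervals (cI.intervalIntegrable 0 (π / 4))
    (cI.intervalIntegrable (π / 4) (π / 2))]
  have hm4 : π / 4 ∈ Icc 0 (π / 2) := ⟨by positivity, hle⟩
  have hlo := hH.lower _ hm4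
  have hup := hH.upper _ hm4
  have hcos : 7 / 10 ≤ cos (π + π / 4 - H (π / 4)) := by
    have h3 : cos (π / 4) ≤ cos (π + π / 4 - H (π / 4)) :=
      cos_le_cos_of_nonneg_of_le_pi (by linarith) (by linarith [pi_pos]) (by linarith)
    rw [cos_pi_div_four] at h3
    have : (1.4 : ℝ) ≤ √2 := le_sqrt_of_sq_le (by norm_num)
    linarith
  have hcos3 : (7 / 10 : ℝ) ^ 3 ≤ cos (π + π / 4 - H (π / 4)) ^ 3 := by gcongr
  rw [hH.mid, show π + π / 2 - π = π / 2 by ring, cos_pi_div_two] at h2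
  nlinarith [pi_lt_d2]

end IsHemisphereProfile

/-! ### Parabolic maximum and comparison principles -/

/-- Second-order necessary condition at a local maximum. -/
lemma deriv_eq_zero_and_deriv_deriv_nonpos {f : ℝ → ℝ} {x : ℝ} (h : IsLocalMax f x)
    (hc : ContinuousAt f x) : deriv f x = 0 ∧ deriv (deriv f) x ≤ 0 := by
  refine ⟨h.deriv_eq_zero, ?_⟩
  by_contra hpos
  push Not at hpos
  have hmin := isLocalMin_of_deriv_deriv_pos hpos h.deriv_eq_zero hc
  have hconst : f =ᶠ[𝓝 x] fun _ => f x := by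
    filter_upwards [h, hmin] with y h1 h2 using le_antisymm h1 h2
  have h1 : deriv f =ᶠ[𝓝 x] fun _ => 0 := by
    have := hconst.deriv
    simpa using this
  have := h1.deriv_eq
  simp at this
  linarith

lemma differentiableAt_deriv {f : ℝ → ℝ} {x : ℝ} (hf : ContDiffAt ℝ 2 f x) :
    DifferentiableAt ℝ (deriv f) x :=
  ((hf.fderiv_right (m := 1) (by norm_num)).differentiableAt one_ne_zero).clm_apply
    (differentiableAt_const 1)

/-- Weak parabolic maximum principle on a closed rectangle. The differential inequality is only
needed at positive spatial maxima. -/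
lemma parabolic_nonpos {T β C : ℝ} {W : ℝ → ℝ → ℝ}
    (hc : ContinuousOn (fun p : ℝ × ℝ => W p.1 p.2) (Icc 0 T ×ˢ Icc 0 β))
    (hinit : ∀ θ ∈ Icc 0 β, W 0 θ ≤ 0) (hl : ∀ t ∈ Icc 0 T, W t 0 ≤ 0)
    (hr : ∀ t ∈ Icc 0 T, W t β ≤ 0)
    (hdt : ∀ t ∈ Ioc 0 T, ∀ θ ∈ Ioo 0 β, DifferentiableAt ℝ (fun s => W s θ) t)
    (hineq : ∀ t ∈ Ioc 0 T, ∀ θ ∈ Ioo 0 β, 0 < W t θ → deriv (W t) θ = 0 →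
      deriv (deriv (W t)) θ ≤ 0 → deriv (fun s => W s θ) t < C * W t θ) :
    ∀ t ∈ Icc 0 T, ∀ θ ∈ Icc 0 β, W t θ ≤ 0 := by
  intro t₁ ht₁ θ₁ hθ₁
  by_contra hpos
  push Not at hpos
  have hcV : ContinuousOn (fun p : ℝ × ℝ => exp (-C * p.1) * W p.1 p.2)
      (Icc 0 T ×ˢ Icc 0 β) :=
    (by fun_prop : Continuous fun p : ℝ × ℝ => exp (-C * p.1)).continuousOn.mul hc
  obtain ⟨⟨t, θ⟩, ⟨ht, hθ⟩, hmax⟩ := (isCompact_Icc.prod isCompact_Icc).exists_isMaxOn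
    ⟨(t₁, θ₁), ht₁, hθ₁⟩ hcV
  have hle : ∀ s ∈ Icc 0 T, ∀ x ∈ Icc 0 β,
      exp (-C * s) * W s x ≤ exp (-C * t) * W t θ := fun s hs x hx =>
    hmax (show (s, x) ∈ Icc 0 T ×ˢ Icc 0 β from ⟨hs, hx⟩)
  simp only at ht hθ
  have hW : 0 < W t θ := by
    have h1 := hle t₁ ht₁ θ₁ hθ₁
    have h2 : 0 < exp (-C * t) * W t θ := (mul_pos (exp_pos _) hpos).trans_le h1
    exact (mul_pos_iff_of_pos_left (exp_pos _)).1 h2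
  have ht0 : 0 < t := lt_of_le_of_ne ht.1 fun h => by
    rw [← h] at hW; exact absurd (hinit θ hθ) (not_le.2 hW)
  have hθ0 : 0 < θ := lt_of_le_of_ne hθ.1 fun h => by
    rw [← h] at hW; exact absurd (hl t ht) (not_le.2 hW)
  have hθβ : θ < β := lt_of_le_of_ne hθ.2 fun h => by
    rw [h] at hW; exact absurd (hr t ht) (not_le.2 hW)
  have hloc : IsLocalMax (W t) θ := by
    filter_upwards [Icc_mem_nhds hθ0 hθβ] with x hx
    exact le_of_mul_le_mul_left (hle t ht x hx) (exp_pos _)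
  have hcx : ContinuousAt (W t) θ := by
    have h1 : ContinuousOn (W t) (Icc 0 β) :=
      hc.comp (f := fun x : ℝ => (t, x)) (by fun_prop) fun x hx => ⟨ht, hx⟩
    exact h1.continuousAt (Icc_mem_nhds hθ0 hθβ)
  obtain ⟨h1, h2⟩ := deriv_eq_zero_and_deriv_deriv_nonpos hloc hcx
  have h3 := hineq t ⟨ht0, ht.2⟩ θ ⟨hθ0, hθβ⟩ hW h1 h2
  have hexp : HasDerivAt (fun s : ℝ => exp (-C * s)) (exp (-C * t) * (-C * 1)) t :=
    ((hasDerivAt_id t).const_mul (-C)).exp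
  have hd := hexp.mul (hdt t ⟨ht0, ht.2⟩ θ ⟨hθ0, hθβ⟩).hasDerivAt
  have hlim := (hasDerivAt_iff_tendsto_slope.1 hd).mono_left
    (nhdsWithin_mono t (s := Iio t) fun s hs => ne_of_lt hs)
  -- the left difference quotients at the maximum are nonnegative
  have hge : 0 ≤ exp (-C * t) * (-C * 1) * W t θ
      + exp (-C * t) * deriv (fun s => W s θ) t := by
    refine ge_of_tendsto hlim ?_
    filter_upwards [Ioo_mem_nhdsLT ht0] with s hs
    rw [slope_def_field]
    refine div_nonneg_of_nonpos ?_ (by linarith [hs.2])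
    have := hle s ⟨hs.1.le, by linarith [hs.2, ht.2]⟩ θ hθ
    simpa using this
  have h4 : exp (-C * t) * (-C * 1) * W t θ + exp (-C * t) * deriv (fun s => W s θ) t =
      exp (-C * t) * (deriv (fun s => W s θ) t - C * W t θ) := by ring
  rw [h4] at hge
  exact absurd (nonneg_of_mul_nonneg_right hge (exp_pos _)) (by linarith)

/-- One-sided Lipschitz bound for the reaction term. Its singular part is monotone in the good
direction near the pole, where the values are close to `π`. -/
lemma reaction_lt {κ s₀ s x y θ : ℝ} (hκ : 0 ≤ κ) (hs₀ : 0 < s₀) (hs : 0 < s) (hxy : y < x)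
    (hnear : s < s₀ → |x - π| ≤ π / 4 ∧ |y - π| ≤ π / 4) :
    (sin (2 * y) / (2 * s ^ 2) + κ / 2 * sin (2 * y - 2 * θ))
      - (sin (2 * x) / (2 * s ^ 2) + κ / 2 * sin (2 * x - 2 * θ))
      < (1 / s₀ ^ 2 + κ + 1) * (x - y) := by
  have h1 : sin (2 * y) / (2 * s ^ 2) - sin (2 * x) / (2 * s ^ 2) ≤ 1 / s₀ ^ 2 * (x - y) := by
    rw [← sub_div, div_le_iff₀ (by positivity)]
    rcases lt_or_ge s s₀ with h | h
    · obtain ⟨hx, hy⟩ := hnear h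
      rw [abs_le] at hx hy
      have : sin (2 * y - 2 * π) ≤ sin (2 * x - 2 * π) :=
        sin_le_sin_of_le_of_le_pi_div_two (by linarith) (by linarith) (by linarith)
      rw [sin_sub_two_pi, sin_sub_two_pi] at this
      have h2 : 0 ≤ 1 / s₀ ^ 2 * (x - y) * (2 * s ^ 2) := by
        have : 0 < x - y := by linarith
        positivity
      linarith
    · have h2 := (le_abs_self _).trans (abs_sin_sub_sin_le (2 * y) (2 * x))
      rw [show 2 * y - 2 * x = -(2 * (x - y)) by ring, abs_neg,
        abs_of_nonneg (by linarith : 0 ≤ 2 * (x - y))] at h2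
      have h3 : 1 ≤ s ^ 2 / s₀ ^ 2 := by rw [one_le_div (by positivity)]; gcongr
      have h4 : 0 < x - y := by linarith
      calc _ ≤ 1 * (2 * (x - y)) := by linarith
        _ ≤ s ^ 2 / s₀ ^ 2 * (2 * (x - y)) := by gcongr
        _ = _ := by ring
  have h2 : sin (2 * y - 2 * θ) - sin (2 * x - 2 * θ) ≤ 2 * (x - y) := by
    have h2 := (le_abs_self _).trans (abs_sin_sub_sin_le (2 * y - 2 * θ) (2 * x - 2 * θ))
    rw [show 2 * y - 2 * θ - (2 * x - 2 * θ) = -(2 * (x - y)) by ring, abs_neg,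
      abs_of_nonneg (by linarith : 0 ≤ 2 * (x - y))] at h2
    exact h2
  have h3 : κ / 2 * (sin (2 * y - 2 * θ) - sin (2 * x - 2 * θ)) ≤ κ / 2 * (2 * (x - y)) := by
    gcongr
  nlinarith

/-- Comparison principle for the profile flow: a subsolution `U` stays below a supersolution `V`
if both stay close to `π` near the poles. -/
lemma flow_comparison {κ T β s₀ : ℝ} (hκ : 0 ≤ κ) (hβ0 : 0 < β) (hβ : β ≤ π) (hs₀ : 0 < s₀)
    {U V : ℝ → ℝ → ℝ}
    (hcU : ContinuousOn (fun p : ℝ × ℝ => U p.1 p.2) (Icc 0 T ×ˢ Icc 0 β))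
    (hcV : ContinuousOn (fun p : ℝ × ℝ => V p.1 p.2) (Icc 0 T ×ˢ Icc 0 β))
    (hinit : ∀ θ ∈ Icc 0 β, U 0 θ ≤ V 0 θ) (hl : ∀ t ∈ Ioc 0 T, U t 0 ≤ V t 0)
    (hr : ∀ t ∈ Ioc 0 T, U t β ≤ V t β)
    (hU : ∀ t ∈ Ioc 0 T, ∀ θ ∈ Ioo 0 β, ContDiffAt ℝ 2 (U t) θ ∧
      DifferentiableAt ℝ (fun s => U s θ) t ∧ deriv (fun s => U s θ) t ≤ tension κ (U t) θ)
    (hV : ∀ t ∈ Ioc 0 T, ∀ θ ∈ Ioo 0 β, ContDiffAt ℝ 2 (V t) θ ∧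
      DifferentiableAt ℝ (fun s => V s θ) t ∧ tension κ (V t) θ ≤ deriv (fun s => V s θ) t)
    (hnear : ∀ t ∈ Ioc 0 T, ∀ θ ∈ Ioo 0 β, sin θ < s₀ → |U t θ - π| ≤ π / 4 ∧
      |V t θ - π| ≤ π / 4) :
    ∀ t ∈ Icc 0 T, ∀ θ ∈ Icc 0 β, U t θ ≤ V t θ := by
  have hb : ∀ x ∈ Icc 0 β, (∀ t ∈ Ioc 0 T, U t x ≤ V t x) → ∀ t ∈ Icc 0 T, U t x - V t x ≤ 0 := by
    intro x hx h t ht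
    rcases eq_or_lt_of_le ht.1 with h0 | h0
    · rw [← h0]; linarith [hinit x hx]
    · linarith [h t ⟨h0, ht.2⟩]
  have key := parabolic_nonpos (T := T) (β := β) (C := 1 / s₀ ^ 2 + κ + 1)
    (W := fun t θ => U t θ - V t θ) (hcU.sub hcV) (fun θ hθ => by linarith [hinit θ hθ])
    (hb 0 ⟨le_rfl, hβ0.le⟩ hl) (hb β ⟨hβ0.le, le_rfl⟩ hr)
    (fun t ht θ hθ => (hU t ht θ hθ).2.1.sub (hV t ht θ hθ).2.1) ?_
  · intro t ht θ hθ
    linarith [key t ht θ hθ]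
  intro t ht θ hθ hpos hd1 hd2
  obtain ⟨u1, u2, u3⟩ := hU t ht θ hθ
  obtain ⟨v1, v2, v3⟩ := hV t ht θ hθ
  have hs : 0 < sin θ := sin_pos_of_mem ⟨hθ.1, hθ.2.trans_le hβ⟩
  have ev : ∀ {f : ℝ → ℝ}, ContDiffAt ℝ 2 f θ → ∀ᶠ x in 𝓝 θ, DifferentiableAt ℝ f x :=
    fun {f} hf => by
      filter_upwards [hf.eventually (by simp)] with x hx
      exact hx.differentiableAt (by norm_num)
  have dd : ∀ {f : ℝ → ℝ}, ContDiffAt ℝ 2 f θ → DifferentiableAt ℝ (deriv f) θ :=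
    fun {f} hf => differentiableAt_deriv hf
  have e1 : deriv (fun θ => U t θ - V t θ) =ᶠ[𝓝 θ] fun x => deriv (U t) x - deriv (V t) x := by
    filter_upwards [ev u1, ev v1] with x h1 h2
    exact deriv_fun_sub h1 h2
  rw [e1.deriv_eq, deriv_fun_sub (dd u1) (dd v1)] at hd2
  rw [e1.eq_of_nhds] at hd1
  rw [deriv_fun_sub u2 v2]
  have h1 := reaction_lt (κ := κ) (s := sin θ) (θ := θ) hκ hs₀ hs (sub_pos.1 hpos)
    (hnear t ht θ hθ)
  unfold tension at u3 v3
  have h2 : cos θ / sin θ * deriv (U t) θ = cos θ / sin θ * deriv (V t) θ := by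
    rw [sub_eq_zero.1 hd1]
  linarith

/-! ### The initial profile -/

lemma kinkAngle_mem {κ : ℝ} (hκ : 4 ≤ κ) : kinkAngle κ ∈ Ico (π / 4) (π / 2) := by
  have h2 : 2 ≤ √κ := le_sqrt_of_sq_le (by linarith)
  unfold kinkAngle
  constructor
  · have : π / (2 * √κ) ≤ π / (2 * 2) := by gcongr
    linarith
  · have : 0 < π / (2 * √κ) := by positivity
    linarith

lemma initialProfile_zero {κ : ℝ} (hκ : 4 ≤ κ) : initialProfile κ 0 = π := by
  have h := kinkAngle_mem hκ
  unfold initialProfile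
  rw [if_pos (by linarith [h.1, pi_pos])]
  simp

lemma initialProfile_pi {κ : ℝ} (hκ : 4 ≤ κ) : initialProfile κ π = π := by
  have h := kinkAngle_mem hκ
  unfold initialProfile
  rw [if_neg (by linarith [h.2, pi_pos]), if_neg (by linarith [h.1, pi_pos])]

lemma initialProfile_add_reflect {κ : ℝ} (hκ : 4 ≤ κ) (θ : ℝ) :
    initialProfile κ θ + initialProfile κ (π - θ) = 2 * π := by
  have h := kinkAngle_mem hκ
  have hk : π / 2 - kinkAngle κ ≠ 0 := by linarith [h.2]
  have hkπ : kinkAngle κ < π - kinkAngle κ := by linarith [h.2]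
  have hm := div_mul_cancel₀ (kinkAngle κ) hk
  unfold initialProfile
  generalize kinkAngle κ / (π / 2 - kinkAngle κ) = m at hm ⊢
  generalize kinkAngle κ = k at *
  split_ifs with h1 h2 h3 h4 h5 h6
  all_goals first | linarith | skip
  · obtain rfl : θ = k := by linarith
    linear_combination -hm
  · obtain rfl : θ = π - k := by linarith
    linear_combination -hm

lemma initialProfile_mem {κ : ℝ} (hκ : 4 ≤ κ) {θ : ℝ} (hθ : θ ∈ Icc 0 (π / 2)) :
    initialProfile κ θ ∈ Icc π (π + θ) := by
  have h := kinkAngle_mem hκ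
  have hk : 0 < π / 2 - kinkAngle κ := by linarith [h.2]
  have hk0 : 0 < kinkAngle κ := by linarith [h.1, pi_pos]
  have h3 : θ ≤ π - kinkAngle κ := by linarith [hθ.2, h.2]
  unfold initialProfile
  generalize kinkAngle κ = k at *
  split_ifs with h1
  · exact ⟨by linarith [hθ.1], le_rfl⟩
  · have h4 : 0 ≤ k / (π / 2 - k) * (π / 2 - θ) := by
      have : 0 ≤ π / 2 - θ := by linarith [hθ.2]
      positivity
    have h5 : k / (π / 2 - k) * (π / 2 - θ) ≤ k / (π / 2 - k) * (π / 2 - k) := by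
      gcongr; linarith
    rw [div_mul_cancel₀ _ hk.ne'] at h5
    constructor <;> linarith

/-! ### Bounds along the flow -/

lemma deriv_const_sub_comp_reflect (F : ℝ → ℝ) (a b : ℝ) :
    deriv (fun x => a - F (b - x)) = fun x => deriv F (b - x) := by
  funext x
  rw [deriv_const_sub, deriv_comp_const_sub, neg_neg]

/-- The reflection `h ↦ 2π - h(π - ·)` is a symmetry of the equation. -/
lemma tension_reflect (κ : ℝ) (F : ℝ → ℝ) (θ : ℝ) :
    tension κ (fun x => 2 * π - F (π - x)) θ = -tension κ F (π - θ) := by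
  have e1 : sin (2 * (2 * π - F (π - θ))) = -sin (2 * F (π - θ)) := by
    rw [show 2 * (2 * π - F (π - θ)) = 2 * π - 2 * F (π - θ) + 2 * π by ring, sin_add_two_pi,
      sin_two_pi_sub]
  have e2 : sin (2 * (2 * π - F (π - θ)) - 2 * θ) = -sin (2 * F (π - θ) - 2 * (π - θ)) := by
    rw [show 2 * (2 * π - F (π - θ)) - 2 * θ = 2 * π - (2 * F (π - θ) - 2 * (π - θ)) by ring,
      sin_two_pi_sub]
  have e3 : deriv (fun x => deriv F (π - x)) θ = -deriv (deriv F) (π - θ) :=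
    deriv_comp_const_sub _ _ _
  unfold tension
  rw [deriv_const_sub_comp_reflect, e1, e2, e3, sin_pi_sub, cos_pi_sub]
  ring

namespace IsProfileFlow

variable {κ : ℝ} {h₀ : ℝ → ℝ} {u : ℝ → ℝ → ℝ}

lemma contDiffAt (hu : IsProfileFlow κ h₀ u) {t θ : ℝ} (ht : 0 < t) (hθ : θ ∈ Ioo 0 π) :
    ContDiffAt ℝ ∞ (fun p : ℝ × ℝ => u p.1 p.2) (t, θ) :=
  hu.smooth.contDiffAt (prod_mem_nhds (Ioi_mem_nhds ht) (Icc_mem_nhds hθ.1 hθ.2))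

lemma contDiffAt_space (hu : IsProfileFlow κ h₀ u) {t θ : ℝ} (ht : 0 < t) (hθ : θ ∈ Ioo 0 π) :
    ContDiffAt ℝ 2 (u t) θ :=
  ((hu.contDiffAt ht hθ).comp (f := fun x : ℝ => (t, x)) θ (by fun_prop)).of_le (by
    norm_cast)

lemma differentiableAt_time (hu : IsProfileFlow κ h₀ u) {t θ : ℝ} (ht : 0 < t)
    (hθ : θ ∈ Ioo 0 π) : DifferentiableAt ℝ (fun s => u s θ) t :=
  ((hu.contDiffAt ht hθ).comp (f := fun x : ℝ => (x, θ)) t (by fun_prop)).differentiableAt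
    (by simp)

lemma deriv_time (hu : IsProfileFlow κ h₀ u) {t θ : ℝ} (ht : 0 < t) (hθ : θ ∈ Ioo 0 π) :
    deriv (fun s => u s θ) t = tension κ (u t) θ := by
  rw [hu.equation t ht θ hθ, iteratedDeriv_succ, iteratedDeriv_one]
  rfl

variable (hu : IsProfileFlow κ (initialProfile κ) u) (hκ : 4 ≤ κ)
include hu hκ

lemma eq_pi_at_zero {t : ℝ} (ht : 0 ≤ t) : u t 0 = π := by
  rcases eq_or_lt_of_le ht with h | h
  · rw [← h, hu.initial 0 ⟨le_rfl, pi_pos.le⟩, initialProfile_zero hκ]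
  · rw [hu.boundary_zero t h, initialProfile_zero hκ]

lemma eq_pi_at_pi {t : ℝ} (ht : 0 ≤ t) : u t π = π := by
  rcases eq_or_lt_of_le ht with h | h
  · rw [← h, hu.initial π ⟨pi_pos.le, le_rfl⟩, initialProfile_pi hκ]
  · rw [hu.boundary_pi t h, initialProfile_pi hκ]

/-- On a bounded time interval the values near the poles are uniformly close to `π`. -/
lemma exists_near_poles (T : ℝ) : ∃ s₀ > 0, s₀ ≤ sin (π / 4) ∧
    ∀ t ∈ Icc 0 T, ∀ θ ∈ Icc 0 π, sin θ < s₀ → |u t θ - π| ≤ π / 4 := by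
  have hcont : ContinuousOn (fun p : ℝ × ℝ => |u p.1 p.2 - π|) (Icc 0 T ×ˢ Icc 0 π) :=
    ((hu.continuousOn.mono (prod_mono_left Icc_subset_Ici_self)).sub continuousOn_const).abs
  set K := (Icc 0 T ×ˢ Icc 0 π) ∩ (fun p : ℝ × ℝ => |u p.1 p.2 - π|) ⁻¹' Ici (π / 4) with hK
  have hKc : IsCompact K := (isCompact_Icc.prod isCompact_Icc).of_isClosed_subset
    (hcont.preimage_isClosed_of_isClosed (isClosed_Icc.prod isClosed_Icc) isClosed_Ici)
    inter_subset_left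
  have h4 : 0 < sin (π / 4) := sin_pos_of_mem ⟨by positivity, by linarith [pi_pos]⟩
  rcases K.eq_empty_or_nonempty with hem | hne
  · refine ⟨sin (π / 4), h4, le_rfl, fun t ht θ hθ _ => ?_⟩
    by_contra hlt
    have : ((t, θ) : ℝ × ℝ) ∈ K := ⟨⟨ht, hθ⟩, (not_le.1 hlt).le⟩
    rw [hem] at this
    exact this
  · obtain ⟨⟨t₁, θ₁⟩, hm, hmin⟩ := hKc.exists_isMinOn hne
      (f := fun p : ℝ × ℝ => sin p.2) (by fun_prop)
    have hmin' : ∀ p ∈ K, sin θ₁ ≤ sin p.2 := isMinOn_iff.1 hmin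
    have hpos : 0 < sin θ₁ := by
      obtain ⟨⟨ht, hθ⟩, hge⟩ := hm
      simp only [mem_preimage, mem_Ici] at hge ht hθ
      refine sin_pos_of_mem ⟨lt_of_le_of_ne hθ.1 fun h => ?_, lt_of_le_of_ne hθ.2 fun h => ?_⟩
      · rw [← h, hu.eq_pi_at_zero hκ ht.1, sub_self, abs_zero] at hge
        linarith [pi_pos]
      · rw [h, hu.eq_pi_at_pi hκ ht.1, sub_self, abs_zero] at hge
        linarith [pi_pos]
    refine ⟨min (sin θ₁) (sin (π / 4)), lt_min hpos h4, min_le_right _ _,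
      fun t ht θ hθ hlt => ?_⟩
    by_contra hcon
    have hmem : ((t, θ) : ℝ × ℝ) ∈ K := ⟨⟨ht, hθ⟩, (not_le.1 hcon).le⟩
    have : sin θ₁ ≤ sin θ := hmin' (t, θ) hmem
    linarith [min_le_left (sin θ₁) (sin (π / 4))]

/-- The flow inherits the symmetry of the initial profile, by uniqueness. -/
lemma add_reflect {t θ : ℝ} (ht : 0 ≤ t) (hθ : θ ∈ Icc 0 π) : u t θ + u t (π - θ) = 2 * π := by
  obtain ⟨s₀, hs₀, -, hnear⟩ := hu.exists_near_poles hκ t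
  have hrefl : ∀ x ∈ Icc 0 π, π - x ∈ Icc 0 π := fun x hx =>
    ⟨by linarith [hx.2], by linarith [hx.1]⟩
  have hrefl' : ∀ x ∈ Ioo 0 π, π - x ∈ Ioo 0 π := fun x hx =>
    ⟨by linarith [hx.2], by linarith [hx.1]⟩
  have hcu : ContinuousOn (fun p : ℝ × ℝ => u p.1 p.2) (Icc 0 t ×ˢ Icc 0 π) :=
    hu.continuousOn.mono (prod_mono_left Icc_subset_Ici_self)
  have hcv : ContinuousOn (fun p : ℝ × ℝ => 2 * π - u p.1 (π - p.2)) (Icc 0 t ×ˢ Icc 0 π) :=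
    continuousOn_const.sub (hcu.comp (f := fun p : ℝ × ℝ => (p.1, π - p.2)) (by fun_prop)
      fun p hp => ⟨hp.1, hrefl _ hp.2⟩)
  have hsu : ∀ s ∈ Ioc 0 t, ∀ x ∈ Ioo 0 π, ContDiffAt ℝ 2 (u s) x ∧
      DifferentiableAt ℝ (fun s => u s x) s ∧ deriv (fun s => u s x) s = tension κ (u s) x :=
    fun s hs x hx => ⟨hu.contDiffAt_space hs.1 hx, hu.differentiableAt_time hs.1 hx,
      hu.deriv_time hs.1 hx⟩
  have hsv : ∀ s ∈ Ioc 0 t, ∀ x ∈ Ioo 0 π, ContDiffAt ℝ 2 (fun x => 2 * π - u s (π - x)) x ∧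
      DifferentiableAt ℝ (fun s => 2 * π - u s (π - x)) s ∧
      deriv (fun s => 2 * π - u s (π - x)) s = tension κ (fun x => 2 * π - u s (π - x)) x := by
    intro s hs x hx
    refine ⟨contDiffAt_const.sub ((hu.contDiffAt_space hs.1 (hrefl' x hx)).comp x
      (f := fun x => π - x) (by fun_prop)),
      (hu.differentiableAt_time hs.1 (hrefl' x hx)).const_sub _, ?_⟩
    rw [deriv_const_sub, hu.deriv_time hs.1 (hrefl' x hx), tension_reflect]
  have hinit : ∀ x ∈ Icc 0 π, u 0 x = 2 * π - u 0 (π - x) := fun x hx => by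
    rw [hu.initial x hx, hu.initial _ (hrefl x hx)]
    linarith [initialProfile_add_reflect hκ x]
  have hl : ∀ s ∈ Ioc 0 t, u s 0 = 2 * π - u s (π - 0) := fun s hs => by
    rw [sub_zero, hu.eq_pi_at_zero hκ hs.1.le, hu.eq_pi_at_pi hκ hs.1.le]; ring
  have hr : ∀ s ∈ Ioc 0 t, u s π = 2 * π - u s (π - π) := fun s hs => by
    rw [sub_self, hu.eq_pi_at_zero hκ hs.1.le, hu.eq_pi_at_pi hκ hs.1.le]; ring
  have hn : ∀ s ∈ Ioc 0 t, ∀ x ∈ Ioo 0 π, sin x < s₀ → |u s x - π| ≤ π / 4 ∧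
      |2 * π - u s (π - x) - π| ≤ π / 4 := by
    intro s hs x hx hlt
    refine ⟨hnear s ⟨hs.1.le, hs.2⟩ x (Ioo_subset_Icc_self hx) hlt, ?_⟩
    rw [show 2 * π - u s (π - x) - π = -(u s (π - x) - π) by ring, abs_neg]
    exact hnear s ⟨hs.1.le, hs.2⟩ _ (Ioo_subset_Icc_self (hrefl' x hx)) (by rwa [sin_pi_sub])
  have hmt : t ∈ Icc 0 t := ⟨ht, le_rfl⟩
  have h1 := flow_comparison (V := fun s x => 2 * π - u s (π - x)) (by linarith) pi_pos le_rfl hs₀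
    hcu hcv (fun x hx => (hinit x hx).le) (fun s hs => (hl s hs).le) (fun s hs => (hr s hs).le)
    (fun s hs x hx => ⟨(hsu s hs x hx).1, (hsu s hs x hx).2.1, (hsu s hs x hx).2.2.le⟩)
    (fun s hs x hx => ⟨(hsv s hs x hx).1, (hsv s hs x hx).2.1, (hsv s hs x hx).2.2.ge⟩)
    hn t hmt θ hθ
  have h2 := flow_comparison (U := fun s x => 2 * π - u s (π - x)) (by linarith) pi_pos le_rfl hs₀
    hcv hcu (fun x hx => (hinit x hx).ge) (fun s hs => (hl s hs).ge) (fun s hs => (hr s hs).ge)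
    (fun s hs x hx => ⟨(hsv s hs x hx).1, (hsv s hs x hx).2.1, (hsv s hs x hx).2.2.le⟩)
    (fun s hs x hx => ⟨(hsu s hs x hx).1, (hsu s hs x hx).2.1, (hsu s hs x hx).2.2.ge⟩)
    (fun s hs x hx hlt => (hn s hs x hx hlt).symm) t hmt θ hθ
  linarith

lemma apply_pi_div_two {t : ℝ} (ht : 0 ≤ t) : u t (π / 2) = π := by
  have := hu.add_reflect hκ ht (θ := π / 2) ⟨by positivity, by linarith [pi_pos]⟩
  rw [show π - π / 2 = π / 2 by ring] at this
  linarith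

/-- On the northern hemisphere the constant `π` is a subsolution and the line `π + θ` a
solution. -/
lemma mem_hemisphere {t θ : ℝ} (ht : 0 ≤ t) (hθ : θ ∈ Icc 0 (π / 2)) :
    u t θ ∈ Icc π (π + θ) := by
  obtain ⟨s₀, hs₀, hs4, hnear⟩ := hu.exists_near_poles hκ t
  have hle : π / 2 ≤ π := by linarith [pi_pos]
  have hcu : ContinuousOn (fun p : ℝ × ℝ => u p.1 p.2) (Icc 0 t ×ˢ Icc 0 (π / 2)) :=
    hu.continuousOn.mono (prod_mono Icc_subset_Ici_self (Icc_subset_Icc_right hle))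
  have hsub : ∀ x ∈ Ioo 0 (π / 2), x ∈ Ioo 0 π := fun x hx => ⟨hx.1, hx.2.trans_le hle⟩
  have hsu : ∀ s ∈ Ioc 0 t, ∀ x ∈ Ioo 0 (π / 2), ContDiffAt ℝ 2 (u s) x ∧
      DifferentiableAt ℝ (fun s => u s x) s ∧ deriv (fun s => u s x) s = tension κ (u s) x :=
    fun s hs x hx => ⟨hu.contDiffAt_space hs.1 (hsub x hx),
      hu.differentiableAt_time hs.1 (hsub x hx), hu.deriv_time hs.1 (hsub x hx)⟩
  have hinit : ∀ x ∈ Icc 0 (π / 2), u 0 x ∈ Icc π (π + x) := fun x hx => by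
    rw [hu.initial x ⟨hx.1, hx.2.trans hle⟩]
    exact initialProfile_mem hκ hx
  have hn : ∀ s ∈ Ioc 0 t, ∀ x ∈ Ioo 0 (π / 2), sin x < s₀ → |u s x - π| ≤ π / 4 :=
    fun s hs x hx => hnear s ⟨hs.1.le, hs.2⟩ x (Ioo_subset_Icc_self (hsub x hx))
  have hmt : t ∈ Icc 0 t := ⟨ht, le_rfl⟩
  constructor
  · refine flow_comparison (U := fun _ _ => π) (by linarith) (by positivity) hle hs₀
      continuousOn_const hcu (fun x hx => (hinit x hx).1)
      (fun s hs => (hu.eq_pi_at_zero hκ hs.1.le).ge)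
      (fun s hs => (hu.apply_pi_div_two hκ hs.1.le).ge) (fun s hs x hx => ⟨contDiffAt_const,
        differentiableAt_const _, ?_⟩)
      (fun s hs x hx => ⟨(hsu s hs x hx).1, (hsu s hs x hx).2.1, (hsu s hs x hx).2.2.ge⟩)
      (fun s hs x hx hlt => ⟨by rw [sub_self, abs_zero]; positivity, hn s hs x hx hlt⟩) t hmt θ hθ
    have : 0 ≤ sin (2 * x) := sin_nonneg_of_nonneg_of_le_pi (by linarith [hx.1])
      (by linarith [hx.2])
    have hκ0 : 0 ≤ κ / 2 * sin (2 * x) := by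
      have : 0 ≤ κ := by linarith
      positivity
    unfold tension
    simp only [deriv_const', sin_two_pi, sin_two_pi_sub, mul_zero, zero_div]
    linarith
  · refine flow_comparison (V := fun _ x => π + x) (by linarith) (by positivity) hle hs₀
      hcu (by fun_prop) (fun x hx => (hinit x hx).2)
      (fun s hs => by rw [hu.eq_pi_at_zero hκ hs.1.le, add_zero])
      (fun s hs => by rw [hu.apply_pi_div_two hκ hs.1.le]; linarith [pi_pos])
      (fun s hs x hx => ⟨(hsu s hs x hx).1, (hsu s hs x hx).2.1, (hsu s hs x hx).2.2.le⟩)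
      (fun s hs x hx => ⟨by fun_prop, differentiableAt_const _, ?_⟩)
      (fun s hs x hx hlt => ⟨hn s hs x hx hlt, ?_⟩) t hmt θ hθ
    · have hd : deriv (fun x : ℝ => π + x) = fun _ => 1 := by
        funext y; simp
      have hs := (sin_pos_of_mem (hsub x hx)).ne'
      unfold tension
      rw [hd, show 2 * (π + x) - 2 * x = 2 * π by ring,
        show 2 * (π + x) = 2 * x + 2 * π by ring, sin_add_two_pi, sin_two_mul, sin_two_pi]
      simp only [deriv_const']
      refine le_of_eq ?_
      field_simp
      ring
    · rw [add_sub_cancel_left, abs_of_pos hx.1]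
      by_contra hcon
      have := sin_lt_sin_of_lt_of_le_pi_div_two (x := π / 4) (y := x) (by linarith [pi_pos])
        hx.2.le (not_le.1 hcon)
      linarith

end IsProfileFlow

/-! ### Iterated integrals of functions continuous on a rectangle -/

lemma exists_continuous_eqOn_rect {F : ℝ × ℝ → ℝ} {a b c d : ℝ} (hab : a ≤ b) (hcd : c ≤ d)
    (hF : ContinuousOn F (Icc a b ×ˢ Icc c d)) :
    ∃ G : ℝ × ℝ → ℝ, Continuous G ∧ EqOn G F (Icc a b ×ˢ Icc c d) := by
  refine ⟨fun p => F (projIcc a b hab p.1, projIcc c d hcd p.2), ?_, ?_⟩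
  · refine hF.comp_continuous ?_ fun p => ⟨Subtype.prop _, Subtype.prop _⟩
    exact (continuous_subtype_val.comp (continuous_projIcc.comp continuous_fst)).prodMk
      (continuous_subtype_val.comp (continuous_projIcc.comp continuous_snd))
  · rintro ⟨x, y⟩ ⟨hx, hy⟩
    simp only at hx hy
    simp [projIcc_of_mem hab hx, projIcc_of_mem hcd hy]

lemma continuousOn_integral_rect {F : ℝ × ℝ → ℝ} {a b c d : ℝ} (hab : a ≤ b) (hcd : c ≤ d)
    (hF : ContinuousOn F (Icc a b ×ˢ Icc c d)) :
    ContinuousOn (fun x => ∫ y in c..d, F (x, y)) (Icc a b) := by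
  obtain ⟨G, hG, hGF⟩ := exists_continuous_eqOn_rect hab hcd hF
  have h1 : Continuous fun x => ∫ y in c..d, G (x, y) :=
    continuous_parametric_intervalIntegral_of_continuous' (f := fun x y => G (x, y)) (by fun_prop)
      c d
  refine h1.continuousOn.congr fun x hx => integral_congr fun y hy => ?_
  rw [uIcc_of_le hcd] at hy
  exact (hGF ⟨hx, hy⟩).symm

lemma continuousOn_slice {F : ℝ × ℝ → ℝ} {a b c d x : ℝ} (hx : x ∈ Icc a b)
    (hF : ContinuousOn F (Icc a b ×ˢ Icc c d)) : ContinuousOn (fun y => F (x, y)) (Icc c d) :=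
  hF.comp (f := fun y : ℝ => (x, y)) (by fun_prop) fun _ hy => ⟨hx, hy⟩

lemma continuousOn_slice' {F : ℝ × ℝ → ℝ} {a b c d y : ℝ} (hy : y ∈ Icc c d)
    (hF : ContinuousOn F (Icc a b ×ˢ Icc c d)) : ContinuousOn (fun x => F (x, y)) (Icc a b) :=
  hF.comp (f := fun x : ℝ => (x, y)) (by fun_prop) fun _ hx => ⟨hx, hy⟩

/-! ### Energy dissipation -/

/-- The time derivative of `u`, as a function on space-time. -/
noncomputable def timeDeriv (u : ℝ → ℝ → ℝ) (p : ℝ × ℝ) : ℝ :=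
  fderiv ℝ (fun q : ℝ × ℝ => u q.1 q.2) p (1, 0)

/-- The derivative of `u` in the polar angle, as a function on space-time. -/
noncomputable def spaceDeriv (u : ℝ → ℝ → ℝ) (p : ℝ × ℝ) : ℝ :=
  fderiv ℝ (fun q : ℝ × ℝ => u q.1 q.2) p (0, 1)

/-- The energy density of the flow, as a function on space-time. -/
noncomputable def flowDensity (κ : ℝ) (u : ℝ → ℝ → ℝ) (p : ℝ × ℝ) : ℝ :=
  1 / 2 * (spaceDeriv u p ^ 2 * sin p.2 + sin (u p.1 p.2) ^ 2 / sin p.2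
    + κ * sin (u p.1 p.2 - p.2) ^ 2 * sin p.2)

lemma hasDerivAt_slice_fst {f : ℝ × ℝ → ℝ} {t θ : ℝ} (hf : DifferentiableAt ℝ f (t, θ)) :
    HasDerivAt (fun s => f (s, θ)) (fderiv ℝ f (t, θ) (1, 0)) t :=
  HasFDerivAt.comp_hasDerivAt (l := f) (f := fun s : ℝ => (s, θ)) t hf.hasFDerivAt
    ((hasDerivAt_id t).prodMk (hasDerivAt_const t θ))

lemma hasDerivAt_slice_snd {f : ℝ × ℝ → ℝ} {t θ : ℝ} (hf : DifferentiableAt ℝ f (t, θ)) :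
    HasDerivAt (fun x => f (t, x)) (fderiv ℝ f (t, θ) (0, 1)) θ :=
  HasFDerivAt.comp_hasDerivAt (l := f) (f := fun x : ℝ => (t, x)) θ hf.hasFDerivAt
    ((hasDerivAt_const θ t).prodMk (hasDerivAt_id θ))

namespace IsProfileFlow

variable {κ : ℝ} {h₀ : ℝ → ℝ} {u : ℝ → ℝ → ℝ}

lemma contDiffAt_timeDeriv (hu : IsProfileFlow κ h₀ u) {p : ℝ × ℝ} (ht : 0 < p.1)
    (hθ : p.2 ∈ Ioo 0 π) : ContDiffAt ℝ 1 (timeDeriv u) p :=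
  ((hu.contDiffAt ht hθ).fderiv_right (m := 1) (by norm_cast)).clm_apply contDiffAt_const

lemma contDiffAt_spaceDeriv (hu : IsProfileFlow κ h₀ u) {p : ℝ × ℝ} (ht : 0 < p.1)
    (hθ : p.2 ∈ Ioo 0 π) : ContDiffAt ℝ 1 (spaceDeriv u) p :=
  ((hu.contDiffAt ht hθ).fderiv_right (m := 1) (by norm_cast)).clm_apply contDiffAt_const

lemma contDiffAt_flowDensity (hu : IsProfileFlow κ h₀ u) {p : ℝ × ℝ} (ht : 0 < p.1)
    (hθ : p.2 ∈ Ioo 0 π) : ContDiffAt ℝ 1 (flowDensity κ u) p := by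
  have h1 := hu.contDiffAt_spaceDeriv ht hθ
  have h2 : ContDiffAt ℝ 1 (fun q : ℝ × ℝ => u q.1 q.2) p :=
    (hu.contDiffAt ht hθ).of_le (by norm_cast)
  have hs : sin p.2 ≠ 0 := (sin_pos_of_mem hθ).ne'
  unfold flowDensity
  fun_prop (disch := assumption)

lemma hasDerivAt_time (hu : IsProfileFlow κ h₀ u) {t θ : ℝ} (ht : 0 < t) (hθ : θ ∈ Ioo 0 π) :
    HasDerivAt (fun s => u s θ) (timeDeriv u (t, θ)) t :=
  hasDerivAt_slice_fst (f := fun q : ℝ × ℝ => u q.1 q.2)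
    ((hu.contDiffAt ht hθ).differentiableAt (by simp))

lemma hasDerivAt_space (hu : IsProfileFlow κ h₀ u) {t θ : ℝ} (ht : 0 < t) (hθ : θ ∈ Ioo 0 π) :
    HasDerivAt (u t) (spaceDeriv u (t, θ)) θ :=
  hasDerivAt_slice_snd (f := fun q : ℝ × ℝ => u q.1 q.2)
    ((hu.contDiffAt ht hθ).differentiableAt (by simp))

lemma timeDeriv_eq_tension (hu : IsProfileFlow κ h₀ u) {t θ : ℝ} (ht : 0 < t)
    (hθ : θ ∈ Ioo 0 π) : timeDeriv u (t, θ) = tension κ (u t) θ := by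
  rw [← hu.deriv_time ht hθ, (hu.hasDerivAt_time ht hθ).deriv]

lemma fderiv_spaceDeriv_snd (hu : IsProfileFlow κ h₀ u) {t θ : ℝ} (ht : 0 < t)
    (hθ : θ ∈ Ioo 0 π) : fderiv ℝ (spaceDeriv u) (t, θ) (0, 1) = deriv (deriv (u t)) θ := by
  have h1 : deriv (u t) =ᶠ[𝓝 θ] fun x => spaceDeriv u (t, x) := by
    filter_upwards [Ioo_mem_nhds hθ.1 hθ.2] with x hx using (hu.hasDerivAt_space ht hx).deriv
  rw [h1.deriv_eq, (hasDerivAt_slice_snd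
    ((hu.contDiffAt_spaceDeriv (p := (t, θ)) ht hθ).differentiableAt one_ne_zero)).deriv]

lemma fderiv_timeDeriv_snd (hu : IsProfileFlow κ h₀ u) {t θ : ℝ} (ht : 0 < t)
    (hθ : θ ∈ Ioo 0 π) :
    fderiv ℝ (timeDeriv u) (t, θ) (0, 1) = fderiv ℝ (spaceDeriv u) (t, θ) (1, 0) := by
  have hsym := (hu.contDiffAt ht hθ).isSymmSndFDerivAt
    (by rw [minSmoothness_of_isRCLikeNormedField]; norm_cast)
  have hd : DifferentiableAt ℝ (fderiv ℝ (fun q : ℝ × ℝ => u q.1 q.2)) (t, θ) :=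
    ((hu.contDiffAt ht hθ).fderiv_right (m := 1) (by norm_cast)).differentiableAt one_ne_zero
  unfold timeDeriv spaceDeriv
  rw [fderiv_clm_apply hd (differentiableAt_const _),
    fderiv_clm_apply hd (differentiableAt_const _)]
  simpa using hsym.eq (0, 1) (1, 0)

/-- The local form of energy dissipation. -/
lemma div_flowDensity (hu : IsProfileFlow κ h₀ u) {t θ : ℝ} (ht : 0 < t) (hθ : θ ∈ Ioo 0 π) :
    fderiv ℝ (flowDensity κ u) (t, θ) (1, 0)
      + fderiv ℝ (fun p : ℝ × ℝ => -(sin p.2 * spaceDeriv u p * timeDeriv u p)) (t, θ) (0, 1)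
      = -(sin θ * timeDeriv u (t, θ) ^ 2) := by
  have hs := (sin_pos_of_mem hθ).ne'
  have dt := (hu.contDiffAt_timeDeriv (p := (t, θ)) ht hθ).differentiableAt one_ne_zero
  have ds := (hu.contDiffAt_spaceDeriv (p := (t, θ)) ht hθ).differentiableAt one_ne_zero
  have h1 := hasDerivAt_slice_fst
    ((hu.contDiffAt_flowDensity (p := (t, θ)) ht hθ).differentiableAt one_ne_zero)
  have h2 : HasDerivAt (fun s => flowDensity κ u (s, θ)) _ t :=
    (((((hasDerivAt_slice_fst ds).pow 2).mul_const (sin θ)).add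
      (((hu.hasDerivAt_time ht hθ).sin.pow 2).div_const (sin θ))).add
      (((((hu.hasDerivAt_time ht hθ).sub_const θ).sin.pow 2).const_mul κ).mul_const
        (sin θ))).const_mul (1 / 2)
  have h3 := hasDerivAt_slice_snd (t := t) (θ := θ)
    (f := fun p : ℝ × ℝ => -(sin p.2 * spaceDeriv u p * timeDeriv u p)) (by fun_prop)
  have h4 : HasDerivAt (fun x => -(sin x * spaceDeriv u (t, x) * timeDeriv u (t, x))) _ θ :=
    (((hasDerivAt_sin θ).mul (hasDerivAt_slice_snd ds)).mul (hasDerivAt_slice_snd dt)).neg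
  rw [h1.unique h2, h3.unique h4, hu.fderiv_spaceDeriv_snd ht hθ, hu.fderiv_timeDeriv_snd ht hθ]
  have h5 := hu.timeDeriv_eq_tension ht hθ
  have h6 : deriv (u t) θ = spaceDeriv u (t, θ) := (hu.hasDerivAt_space ht hθ).deriv
  have h7 := sin_sq_mul_tension κ (u t) hθ
  rw [← h5, h6, sin_two_mul, show 2 * u t θ - 2 * θ = 2 * (u t θ - θ) by ring, sin_two_mul] at h7
  have h8 : deriv (deriv (u t)) θ = timeDeriv u (t, θ) - (sin θ * cos θ * spaceDeriv u (t, θ)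
      - sin (u t θ) * cos (u t θ)
      - κ * sin θ ^ 2 * (sin (u t θ - θ) * cos (u t θ - θ))) / sin θ ^ 2 := by
    field_simp
    linear_combination -h7
  rw [h8]
  simp only [Pi.mul_apply]
  push_cast
  field_simp
  ring

/-- The energy identity on a rectangle, with the flux through its sides. -/
lemma energy_identity (hu : IsProfileFlow κ h₀ u) {T a b : ℝ} (hT : 1 ≤ T) (ha : 0 < a)
    (hab : a ≤ b) (hb : b < π) :
    ∫ t in (1 : ℝ)..T, ∫ θ in a..b, sin θ * timeDeriv u (t, θ) ^ 2 =
      (∫ θ in a..b, flowDensity κ u (1, θ)) - (∫ θ in a..b, flowDensity κ u (T, θ))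
      + ((∫ t in (1 : ℝ)..T, sin b * spaceDeriv u (t, b) * timeDeriv u (t, b))
      - ∫ t in (1 : ℝ)..T, sin a * spaceDeriv u (t, a) * timeDeriv u (t, a)) := by
  have hmem : ∀ p ∈ Icc 1 T ×ˢ Icc a b, 0 < p.1 ∧ p.2 ∈ Ioo 0 π := fun p hp =>
    ⟨by linarith [hp.1.1], by linarith [hp.2.1], by linarith [hp.2.2]⟩
  have hsub : Ioo 1 T ×ˢ Ioo a b ⊆ Icc 1 T ×ˢ Icc a b :=
    prod_mono Ioo_subset_Icc_self Ioo_subset_Icc_self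
  have c1 : ∀ p ∈ Icc 1 T ×ˢ Icc a b, ContDiffAt ℝ 1 (flowDensity κ u) p := fun p hp =>
    hu.contDiffAt_flowDensity (hmem p hp).1 (hmem p hp).2
  have c2 : ∀ p ∈ Icc 1 T ×ˢ Icc a b,
      ContDiffAt ℝ 1 (fun p : ℝ × ℝ => -(sin p.2 * spaceDeriv u p * timeDeriv u p)) p :=
    fun p hp => by
      have h1 := hu.contDiffAt_timeDeriv (hmem p hp).1 (hmem p hp).2
      have h2 := hu.contDiffAt_spaceDeriv (hmem p hp).1 (hmem p hp).2
      fun_prop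
  have hdiv : EqOn (fun p => fderiv ℝ (flowDensity κ u) p (1, 0)
      + fderiv ℝ (fun p : ℝ × ℝ => -(sin p.2 * spaceDeriv u p * timeDeriv u p)) p (0, 1))
      (fun p => -(sin p.2 * timeDeriv u p ^ 2)) (Icc 1 T ×ˢ Icc a b) := fun p hp =>
    hu.div_flowDensity (hmem p hp).1 (hmem p hp).2
  have hcd : ContinuousOn (fun p : ℝ × ℝ => -(sin p.2 * timeDeriv u p ^ 2))
      (Icc 1 T ×ˢ Icc a b) := fun p hp => by
    have h1 := (hu.contDiffAt_timeDeriv (hmem p hp).1 (hmem p hp).2).continuousAt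
    refine ContinuousAt.continuousWithinAt ?_
    fun_prop
  have key := integral2_divergence_prod_of_hasFDerivAt (flowDensity κ u)
    (fun p : ℝ × ℝ => -(sin p.2 * spaceDeriv u p * timeDeriv u p))
    (fderiv ℝ (flowDensity κ u))
    (fderiv ℝ (fun p : ℝ × ℝ => -(sin p.2 * spaceDeriv u p * timeDeriv u p))) 1 a T b
    (by rw [uIcc_of_le hT, uIcc_of_le hab]
        exact fun p hp => (c1 p hp).continuousAt.continuousWithinAt)
    (by rw [uIcc_of_le hT, uIcc_of_le hab]
        exact fun p hp => (c2 p hp).continuousAt.continuousWithinAt)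
    (by rw [min_eq_left hT, max_eq_right hT, min_eq_left hab, max_eq_right hab]
        exact fun p hp => ((c1 p (hsub hp)).differentiableAt one_ne_zero).hasFDerivAt)
    (by rw [min_eq_left hT, max_eq_right hT, min_eq_left hab, max_eq_right hab]
        exact fun p hp => ((c2 p (hsub hp)).differentiableAt one_ne_zero).hasFDerivAt)
    (by rw [uIcc_of_le hT, uIcc_of_le hab]
        exact (hcd.congr hdiv).integrableOn_compact (isCompact_Icc.prod isCompact_Icc))
  have hL : (∫ t in (1 : ℝ)..T, ∫ θ in a..b, fderiv ℝ (flowDensity κ u) (t, θ) (1, 0)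
      + fderiv ℝ (fun p : ℝ × ℝ => -(sin p.2 * spaceDeriv u p * timeDeriv u p)) (t, θ) (0, 1)) =
      -∫ t in (1 : ℝ)..T, ∫ θ in a..b, sin θ * timeDeriv u (t, θ) ^ 2 := by
    rw [← intervalIntegral.integral_neg]
    refine integral_congr fun t ht => ?_
    rw [← intervalIntegral.integral_neg]
    refine integral_congr fun θ hθ => ?_
    rw [uIcc_of_le hT] at ht
    rw [uIcc_of_le hab] at hθ
    exact hdiv (x := (t, θ)) ⟨ht, hθ⟩
  rw [hL] at key
  simp only [intervalIntegral.integral_neg] at key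
  linarith

/-- Smoothness up to the poles bounds the first derivatives on bounded time intervals. -/
lemma exists_deriv_bound (hu : IsProfileFlow κ h₀ u) (T : ℝ) : ∃ C, 0 ≤ C ∧
    ∀ t ∈ Icc 1 T, ∀ θ ∈ Ioo 0 π, |timeDeriv u (t, θ)| ≤ C ∧ |spaceDeriv u (t, θ)| ≤ C := by
  have hud : UniqueDiffOn ℝ (Ioi (0 : ℝ) ×ˢ Icc 0 π) :=
    isOpen_Ioi.uniqueDiffOn.prod (uniqueDiffOn_Icc pi_pos)
  have hc := hu.smooth.continuousOn_fderivWithin hud (by simp)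
  obtain ⟨C, hC⟩ := ((isCompact_Icc (a := (1 : ℝ)) (b := T)).prod
    (isCompact_Icc (a := (0 : ℝ)) (b := π))).exists_bound_of_continuousOn
    (hc.mono (prod_mono_left fun t ht => mem_Ioi.2 (by linarith [ht.1])))
  refine ⟨max C 0, le_max_right _ _, fun t ht θ hθ => ?_⟩
  have h1 := hC (t, θ) ⟨ht, Ioo_subset_Icc_self hθ⟩
  rw [fderivWithin_of_mem_nhds (prod_mem_nhds (Ioi_mem_nhds (by linarith [ht.1]))
    (Icc_mem_nhds hθ.1 hθ.2))] at h1
  have h2 : ∀ v : ℝ × ℝ, ‖v‖ = 1 → |fderiv ℝ (fun q : ℝ × ℝ => u q.1 q.2) (t, θ) v| ≤ max C 0 :=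
    fun v hv => by
      have := (fderiv ℝ (fun q : ℝ × ℝ => u q.1 q.2) (t, θ)).le_opNorm v
      rw [hv, mul_one] at this
      exact this.trans (h1.trans (le_max_left _ _))
  exact ⟨h2 _ (by simp [Prod.norm_def]), h2 _ (by simp [Prod.norm_def])⟩

variable (hu : IsProfileFlow κ (initialProfile κ) u) (hκ : 4 ≤ κ)
include hu

lemma continuousOn_timeDeriv {T₁ T₂ a b : ℝ} (hT : 0 < T₁) (ha : 0 < a) (hb : b < π) :
    ContinuousOn (timeDeriv u) (Icc T₁ T₂ ×ˢ Icc a b) := fun _ hp =>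
  (hu.contDiffAt_timeDeriv (hT.trans_le hp.1.1)
    ⟨ha.trans_le hp.2.1, hp.2.2.trans_lt hb⟩).continuousAt.continuousWithinAt

/-- The profile at a positive time extends to a smooth function on the line. -/
lemma exists_extension {t : ℝ} (ht : 0 < t) :
    ∃ V : ℝ → ℝ, ContDiff ℝ 2 V ∧ EqOn V (u t) (Icc 0 π) := by
  refine exists_contDiff_extension pi_pos 2 ?_
  exact (hu.smooth.comp (f := fun x : ℝ => (t, x)) (by fun_prop) fun x hx => ⟨ht, hx⟩).of_le
    (by norm_cast)

include hκ

/-- The energy at time `1` is finite and bounds that of all subintervals. -/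
lemma exists_energy_bound : ∃ M, ∀ a b, 0 < a → a ≤ b → b < π →
    ∫ θ in a..b, flowDensity κ u (1, θ) ≤ M := by
  obtain ⟨V, hV, hVu⟩ := hu.exists_extension one_pos
  have hV1 : ContDiff ℝ 1 V := hV.of_le (by norm_num)
  have cV := hV.continuous
  have cV' := hV1.continuous_deriv le_rfl
  have h0 : V 0 = π := by
    rw [hVu ⟨le_rfl, pi_pos.le⟩, hu.eq_pi_at_zero hκ one_pos.le]
  have hπ : V π = π := by
    rw [hVu ⟨pi_pos.le, le_rfl⟩, hu.eq_pi_at_pi hκ one_pos.le]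
  set e : ℝ → ℝ := fun θ => 1 / 2 * (deriv V θ ^ 2 * sin θ + sin (V θ) ^ 2 / sin θ
    + κ * sin (V θ - θ) ^ 2 * sin θ) with he
  have hint : IntervalIntegrable e volume 0 π := by
    have c1 : Continuous fun θ => deriv V θ ^ 2 * sin θ := by fun_prop
    have c2 : Continuous fun θ => κ * sin (V θ - θ) ^ 2 * sin θ := by fun_prop
    exact (((c1.intervalIntegrable _ _).add (intervalIntegrable_sin_sq_div hV1 h0 hπ)).add
      (c2.intervalIntegrable _ _)).const_mul _
  refine ⟨∫ θ in (0 : ℝ)..π, e θ, fun a b ha hab hb => ?_⟩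
  have heq : ∫ θ in a..b, flowDensity κ u (1, θ) = ∫ θ in a..b, e θ := by
    refine integral_congr fun θ hθ => ?_
    rw [uIcc_of_le hab] at hθ
    have hθ' : θ ∈ Ioo 0 π := ⟨ha.trans_le hθ.1, hθ.2.trans_lt hb⟩
    have h1 : V =ᶠ[𝓝 θ] u 1 := hVu.eventuallyEq_of_mem (Icc_mem_nhds hθ'.1 hθ'.2)
    simp only [he, flowDensity, h1.deriv_eq, h1.eq_of_nhds,
      (hu.hasDerivAt_space one_pos hθ').deriv]
  rw [heq]
  refine integral_mono_interval ha.le hab hb.le ?_ hint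
  refine (ae_restrict_iff' measurableSet_Ioc).2 (Eventually.of_forall fun θ hθ => ?_)
  have : 0 ≤ sin θ := sin_nonneg_of_nonneg_of_le_pi hθ.1.le hθ.2
  have : 0 ≤ κ := by linarith
  simp only [he, Pi.zero_apply]
  positivity

/-- The total dissipation on a compact subinterval is bounded uniformly in time; the flux through
the poles vanishes since `sin θ` does. -/
lemma exists_dissipation_bound : ∃ M, ∀ a b, 0 < a → a ≤ b → b < π → ∀ T, 1 ≤ T →
    ∫ t in (1 : ℝ)..T, ∫ θ in a..b, sin θ * timeDeriv u (t, θ) ^ 2 ≤ M := by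
  obtain ⟨M, hM⟩ := hu.exists_energy_bound hκ
  refine ⟨M, fun a b ha hab hb T hT => ?_⟩
  obtain ⟨C, hC0, hC⟩ := hu.exists_deriv_bound T
  have hc : ∀ a b, 0 < a → b < π → ContinuousOn
      (fun p : ℝ × ℝ => sin p.2 * timeDeriv u p ^ 2) (Icc 1 T ×ˢ Icc a b) := fun a b ha hb =>
    (by fun_prop : Continuous fun p : ℝ × ℝ => sin p.2).continuousOn.mul
      ((hu.continuousOn_timeDeriv one_pos ha hb).pow 2)
  have flux : ∀ x ∈ Ioo 0 π,
      |∫ t in (1 : ℝ)..T, sin x * spaceDeriv u (t, x) * timeDeriv u (t, x)|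
        ≤ sin x * C * C * |T - 1| := by
    intro x hx
    rw [← norm_eq_abs]
    refine intervalIntegral.norm_integral_le_of_norm_le_const fun t ht => ?_
    rw [uIoc_of_le hT] at ht
    obtain ⟨h1, h2⟩ := hC t ⟨ht.1.le, ht.2⟩ x hx
    have hs := sin_pos_of_mem hx
    rw [norm_eq_abs, abs_mul, abs_mul, abs_of_pos hs]
    gcongr
  -- enlarge `[a, b]` to `[ε, π - ε]` and let the flux through the ends vanish as `ε → 0`
  have key : ∀ ε ∈ Ioo 0 (min a (π - b)),
      ∫ t in (1 : ℝ)..T, ∫ θ in a..b, sin θ * timeDeriv u (t, θ) ^ 2 ≤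
        M + 2 * (sin ε * C * C * |T - 1|) := by
    intro ε hε
    have hεa : ε < a := hε.2.trans_le (min_le_left _ _)
    have hεb : ε < π - b := hε.2.trans_le (min_le_right _ _)
    have hεm : ε ∈ Ioo 0 π := ⟨hε.1, by linarith⟩
    have hεm' : π - ε ∈ Ioo 0 π := ⟨by linarith, by linarith [hε.1]⟩
    have hle : ε ≤ π - ε := by linarith
    have h1 : ∫ t in (1 : ℝ)..T, ∫ θ in a..b, sin θ * timeDeriv u (t, θ) ^ 2 ≤
        ∫ t in (1 : ℝ)..T, ∫ θ in ε..(π - ε), sin θ * timeDeriv u (t, θ) ^ 2 := by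
      refine integral_mono_on hT
        ((continuousOn_integral_rect hT hab (hc a b ha hb)).intervalIntegrable_of_Icc hT)
        ((continuousOn_integral_rect hT hle (hc _ _ hεm.1 hεm'.2)).intervalIntegrable_of_Icc hT)
        fun t ht => ?_
      refine integral_mono_interval hεa.le hab (by linarith) ?_
        ((continuousOn_slice ht (hc _ _ hεm.1 hεm'.2)).intervalIntegrable_of_Icc hle)
      refine (ae_restrict_iff' measurableSet_Ioc).2 (Eventually.of_forall fun θ hθ => ?_)
      have : 0 ≤ sin θ := sin_nonneg_of_nonneg_of_le_pi (hε.1.le.trans hθ.1.le)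
        (hθ.2.trans hεm'.2.le)
      simp only [Pi.zero_apply]
      positivity
    have h2 := hu.energy_identity hT hεm.1 hle hεm'.2
    have h3 : 0 ≤ ∫ θ in ε..(π - ε), flowDensity κ u (T, θ) := by
      refine integral_nonneg hle fun θ hθ => ?_
      have : 0 ≤ sin θ := sin_nonneg_of_nonneg_of_le_pi (hε.1.le.trans hθ.1)
        (hθ.2.trans hεm'.2.le)
      have : 0 ≤ κ := by linarith
      unfold flowDensity
      simp only
      positivity
    have h4 := abs_le.1 (flux ε hεm)
    have h5 := abs_le.1 (flux _ hεm')
    have h6 := hM ε (π - ε) hεm.1 hle hεm'.2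
    rw [sin_pi_sub] at h5
    rw [sin_pi_sub] at h2
    linarith [h4.1, h5.2]
  have hlim : Tendsto (fun ε => M + 2 * (sin ε * C * C * |T - 1|)) (𝓝[>] 0) (𝓝 M) := by
    have : Continuous fun ε => M + 2 * (sin ε * C * C * |T - 1|) := by fun_prop
    have h := (this.tendsto 0).mono_left (nhdsWithin_le_nhds (s := Ioi 0))
    simpa using h
  refine ge_of_tendsto hlim ?_
  filter_upwards [Ioo_mem_nhdsGT (lt_min ha (by linarith : 0 < π - b))] with ε hε using key ε hε

end IsProfileFlow

/-! ### Decay of the time derivative -/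

/-- Unit tails of a convergent integral of a nonnegative function tend to zero. -/
lemma tendsto_integral_unit_window {f : ℝ → ℝ} {M : ℝ} (hf : ∀ T, ContinuousOn f (Icc 1 T))
    (h0 : ∀ t, 1 ≤ t → 0 ≤ f t) (hM : ∀ T, 1 ≤ T → ∫ t in (1 : ℝ)..T, f t ≤ M) :
    Tendsto (fun τ => ∫ t in τ..(τ + 1), f t) atTop (𝓝 0) := by
  have hint : ∀ x y, 1 ≤ x → x ≤ y → IntervalIntegrable f volume x y := fun x y hx hxy =>
    ((hf y).mono (Icc_subset_Icc_left hx)).intervalIntegrable_of_Icc hxy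
  have hadd : ∀ x y, 1 ≤ x → x ≤ y →
      (∫ t in (1 : ℝ)..y, f t) - ∫ t in (1 : ℝ)..x, f t = ∫ t in x..y, f t := fun x y hx hxy =>
    integral_interval_sub_left (hint 1 y le_rfl (hx.trans hxy)) (hint 1 x le_rfl hx)
  have hmono : Monotone fun T => ∫ t in (1 : ℝ)..(max 1 T), f t := by
    intro x y hxy
    have h1 := hadd (max 1 x) (max 1 y) (le_max_left _ _) (max_le_max le_rfl hxy)
    have h2 : 0 ≤ ∫ t in (max 1 x)..(max 1 y), f t :=
      integral_nonneg (max_le_max le_rfl hxy) fun t ht => h0 t ((le_max_left _ _).trans ht.1)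
    simp only
    linarith
  have hbdd : BddAbove (range fun T => ∫ t in (1 : ℝ)..(max 1 T), f t) :=
    ⟨M, by rintro _ ⟨T, rfl⟩; exact hM _ (le_max_left _ _)⟩
  have h1 := tendsto_atTop_ciSup hmono hbdd
  have h2 := (h1.comp (tendsto_atTop_add_const_right atTop 1 tendsto_id)).sub h1
  rw [sub_self] at h2
  refine h2.congr' ?_
  filter_upwards [eventually_ge_atTop 1] with τ hτ
  simp only [Function.comp, id]
  rw [max_eq_right hτ, max_eq_right (by linarith : 1 ≤ τ + 1), hadd τ (τ + 1) hτ (by linarith)]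

/-- The sine is bounded below on a compact subinterval of `(0, π)`. -/
lemma exists_le_sin {a b : ℝ} (ha : 0 < a) (hb : b < π) :
    ∃ m > 0, ∀ θ ∈ Icc a b, m ≤ sin θ := by
  rcases le_or_gt a b with hab | hab
  · obtain ⟨x, hx, hmin⟩ := (isCompact_Icc (a := a) (b := b)).exists_isMinOn ⟨a, le_rfl, hab⟩
      continuous_sin.continuousOn
    exact ⟨sin x, sin_pos_of_mem ⟨ha.trans_le hx.1, hx.2.trans_lt hb⟩, isMinOn_iff.1 hmin⟩
  · exact ⟨1, one_pos, fun θ hθ => absurd (hθ.1.trans hθ.2) (not_le.2 hab)⟩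

namespace IsProfileFlow

variable {κ : ℝ} {u : ℝ → ℝ → ℝ} (hu : IsProfileFlow κ (initialProfile κ) u) (hκ : 4 ≤ κ)
include hu hκ

lemma tendsto_integral_abs_timeDeriv {a b : ℝ} (ha : 0 < a) (hab : a < b) (hb : b < π) :
    Tendsto (fun τ => ∫ t in τ..(τ + 1), ∫ θ in a..b, |timeDeriv u (t, θ)|) atTop (𝓝 0) := by
  obtain ⟨M, hM⟩ := hu.exists_dissipation_bound hκ
  obtain ⟨m, hm, hms⟩ := exists_le_sin ha hb
  have hct : ∀ T₁ T₂ : ℝ, 1 ≤ T₁ → ContinuousOn (timeDeriv u) (Icc T₁ T₂ ×ˢ Icc a b) :=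
    fun T₁ T₂ h => hu.continuousOn_timeDeriv (by linarith) ha hb
  have hcd : ∀ T₁ T₂ : ℝ, 1 ≤ T₁ → ContinuousOn (fun p : ℝ × ℝ => sin p.2 * timeDeriv u p ^ 2)
      (Icc T₁ T₂ ×ˢ Icc a b) := fun T₁ T₂ h =>
    (by fun_prop : Continuous fun p : ℝ × ℝ => sin p.2).continuousOn.mul ((hct T₁ T₂ h).pow 2)
  have htail := tendsto_integral_unit_window (M := M)
    (f := fun t => ∫ θ in a..b, sin θ * timeDeriv u (t, θ) ^ 2) (fun T => by
      rcases le_or_gt 1 T with hT | hT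
      · exact continuousOn_integral_rect hT hab.le (hcd 1 T le_rfl)
      · rw [Icc_eq_empty (not_le.2 hT)]; exact continuousOn_empty _)
    (fun t _ => integral_nonneg hab.le fun θ hθ => by
      have := hm.le.trans (hms θ hθ)
      positivity)
    (fun T hT => hM a b ha hab.le hb T hT)
  have hba : 0 < b - a := by linarith
  rw [tendsto_order]
  constructor
  · intro c hc
    filter_upwards with τ
    refine hc.trans_le (integral_nonneg (by linarith) fun t _ => integral_nonneg hab.le
      fun θ _ => abs_nonneg _)
  · intro ε hε
    -- Young's inequality with a small parameter replaces the Cauchy-Schwarz inequality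
    obtain ⟨δ, hδ⟩ : ∃ δ, δ = ε / (2 * (b - a)) := ⟨_, rfl⟩
    have hδ0 : 0 < δ := by rw [hδ]; positivity
    have hlt := (tendsto_order.1 htail).2 (ε / 2 * (4 * δ * m)) (by positivity)
    filter_upwards [hlt, eventually_ge_atTop 1] with τ h1 hτ
    have hle : τ ≤ τ + 1 := by linarith
    have hin : ∀ t ∈ Icc τ (τ + 1), ∫ θ in a..b, |timeDeriv u (t, θ)| ≤
        δ * (b - a) + (∫ θ in a..b, sin θ * timeDeriv u (t, θ) ^ 2) / (4 * δ * m) := by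
      intro t ht
      have ci : IntervalIntegrable (fun θ => sin θ * timeDeriv u (t, θ) ^ 2) volume a b :=
        (continuousOn_slice ht (hcd τ (τ + 1) hτ)).intervalIntegrable_of_Icc hab.le
      have : δ * (b - a) + (∫ θ in a..b, sin θ * timeDeriv u (t, θ) ^ 2) / (4 * δ * m) =
          ∫ θ in a..b, (δ + sin θ * timeDeriv u (t, θ) ^ 2 / (4 * δ * m)) := by
        rw [intervalIntegral.integral_add (by simp) (ci.div_const _),
          intervalIntegral.integral_div, intervalIntegral.integral_const, smul_eq_mul, mul_comm δ]
      rw [this]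
      refine integral_mono_on hab.le
        ((continuousOn_slice ht (hct τ (τ + 1) hτ)).abs.intervalIntegrable_of_Icc hab.le)
        (intervalIntegrable_const.add (ci.div_const _)) fun θ hθ => ?_
      have hsm := hms θ hθ
      generalize timeDeriv u (t, θ) = x
      have h2 : |x| ≤ δ + x ^ 2 / (4 * δ) := by
        rw [← sub_le_iff_le_add', le_div_iff₀ (by positivity), ← sq_abs x]
        nlinarith [sq_nonneg (|x| - 2 * δ)]
      have h3 : x ^ 2 / (4 * δ) ≤ sin θ * x ^ 2 / (4 * δ * m) := by
        rw [div_le_div_iff₀ (by positivity) (by positivity)]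
        have : m * (x ^ 2 * (4 * δ)) ≤ sin θ * (x ^ 2 * (4 * δ)) := by gcongr
        linarith
      linarith
    have ci2 := (continuousOn_integral_rect hle hab.le
      (hcd τ (τ + 1) hτ)).intervalIntegrable_of_Icc (μ := volume) hle
    have h3 : ∫ t in τ..(τ + 1), ∫ θ in a..b, |timeDeriv u (t, θ)| ≤
        ∫ t in τ..(τ + 1), (δ * (b - a)
          + (∫ θ in a..b, sin θ * timeDeriv u (t, θ) ^ 2) / (4 * δ * m)) :=
      integral_mono_on hle ((continuousOn_integral_rect hle hab.le
        (hct τ (τ + 1) hτ).abs).intervalIntegrable_of_Icc hle)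
        (intervalIntegrable_const.add (ci2.div_const _)) hin
    rw [intervalIntegral.integral_add (by simp) (ci2.div_const _), intervalIntegral.integral_div,
      intervalIntegral.integral_const, smul_eq_mul, add_sub_cancel_left, one_mul] at h3
    have h4 : (∫ t in τ..(τ + 1), ∫ θ in a..b, sin θ * timeDeriv u (t, θ) ^ 2) / (4 * δ * m)
        < ε / 2 := by
      rw [div_lt_iff₀ (by positivity)]; exact h1
    have h5 : δ * (b - a) = ε / 2 := by rw [hδ]; field_simp
    linarith

omit hκ in
/-- In every unit time window there is a time at which both `u_t` and the distance travelled are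
controlled, in `L¹`, by the space-time integral of `|u_t|`. -/
lemma exists_good_time {a b τ : ℝ} (ha : 0 < a) (hab : a < b) (hb : b < π) (hτ : 1 ≤ τ) :
    ∃ t ∈ Icc τ (τ + 1),
      ∫ θ in a..b, |timeDeriv u (t, θ)| ≤
        ∫ t in τ..(τ + 1), ∫ θ in a..b, |timeDeriv u (t, θ)| ∧
      ∫ θ in a..b, |u t θ - u τ θ| ≤ ∫ t in τ..(τ + 1), ∫ θ in a..b, |timeDeriv u (t, θ)| := by
  have hle : τ ≤ τ + 1 := by linarith
  have hct : ContinuousOn (timeDeriv u) (Icc τ (τ + 1) ×ˢ Icc a b) :=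
    hu.continuousOn_timeDeriv (by linarith) ha hb
  have hcu : ContinuousOn (fun p : ℝ × ℝ => u p.1 p.2) (Icc τ (τ + 1) ×ˢ Icc a b) :=
    hu.continuousOn.mono (prod_mono (fun t ht => mem_Ici.2 (by linarith [ht.1]))
      (Icc_subset_Icc ha.le hb.le))
  have hci := continuousOn_integral_rect hle hab.le hct.abs
  obtain ⟨t, ht, hmin⟩ := isCompact_Icc.exists_isMinOn ⟨τ, le_rfl, hle⟩ hci
  refine ⟨t, ht, ?_, ?_⟩
  · have h1 := integral_mono_on hle (intervalIntegrable_const (μ := volume))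
      (hci.intervalIntegrable_of_Icc hle) fun s hs => isMinOn_iff.1 hmin s hs
    simpa using h1
  · rw [intervalIntegral_intervalIntegral_swap (F := fun t θ => |timeDeriv u (t, θ)|)]
    · refine integral_mono_on hab.le (((continuousOn_slice ht hcu).sub
        (continuousOn_slice ⟨le_rfl, hle⟩ hcu)).abs.intervalIntegrable_of_Icc hab.le) ?_
        fun θ hθ => ?_
      · have hsw : ContinuousOn (fun q : ℝ × ℝ => |timeDeriv u (q.2, q.1)|)
            (Icc a b ×ˢ Icc τ (τ + 1)) :=
          hct.abs.comp (f := fun q : ℝ × ℝ => (q.2, q.1)) (by fun_prop) fun q hq => ⟨hq.2, hq.1⟩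
        exact (continuousOn_integral_rect hab.le hle hsw).intervalIntegrable_of_Icc hab.le
      · have hθ' : θ ∈ Ioo 0 π := ⟨ha.trans_le hθ.1, hθ.2.trans_lt hb⟩
        have hsl := continuousOn_slice' hθ hct
        have hftc : ∫ s in τ..t, timeDeriv u (s, θ) = u t θ - u τ θ := by
          refine integral_eq_sub_of_hasDerivAt (f := fun s => u s θ) (fun s hs => ?_)
            ((hsl.mono (Icc_subset_Icc_right ht.2)).intervalIntegrable_of_Icc ht.1)
          rw [uIcc_of_le ht.1] at hs
          exact hu.hasDerivAt_time (by linarith [hs.1]) hθ'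
        rw [← hftc]
        refine (abs_integral_le_integral_abs ht.1).trans ?_
        exact integral_mono_interval le_rfl ht.1 ht.2
          (Eventually.of_forall fun s => abs_nonneg _) (hsl.abs.intervalIntegrable_of_Icc hle)
    · rw [uIoc_of_le hle, uIoc_of_le hab.le]
      exact (hct.abs.integrableOn_compact (isCompact_Icc.prod isCompact_Icc)).mono_set
        (prod_mono Ioc_subset_Icc_self Ioc_subset_Icc_self)

end IsProfileFlow

/-! ### The weak form of the equation -/

/-- A test function on `[a, b]` vanishing to second order at the endpoints. -/
noncomputable def bump (a b θ : ℝ) : ℝ := (θ - a) ^ 2 * (b - θ) ^ 2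

/-- The derivative of `bump`. -/
noncomputable def bumpDeriv (a b θ : ℝ) : ℝ :=
  2 * (θ - a) * (b - θ) ^ 2 - 2 * (θ - a) ^ 2 * (b - θ)

/-- The second derivative of `bump`. -/
noncomputable def bumpDeriv2 (a b θ : ℝ) : ℝ :=
  2 * (b - θ) ^ 2 - 8 * (θ - a) * (b - θ) + 2 * (θ - a) ^ 2

lemma hasDerivAt_bump (a b θ : ℝ) : HasDerivAt (bump a b) (bumpDeriv a b θ) θ := by
  refine ((((hasDerivAt_id θ).sub_const a).pow 2).mul
    (((hasDerivAt_id θ).const_sub b).pow 2)).congr_deriv ?_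
  simp [bumpDeriv]
  ring

lemma hasDerivAt_bumpDeriv (a b θ : ℝ) :
    HasDerivAt (bumpDeriv a b) (bumpDeriv2 a b θ) θ := by
  refine (((((hasDerivAt_id θ).sub_const a).const_mul 2).mul
    (((hasDerivAt_id θ).const_sub b).pow 2)).sub
    (((((hasDerivAt_id θ).sub_const a).pow 2).const_mul 2).mul
    ((hasDerivAt_id θ).const_sub b))).congr_deriv ?_
  simp [bumpDeriv2]
  ring

/-- The equation tested against `bump a b`, with all derivatives moved to the test function. -/
noncomputable def weakForm (κ a b : ℝ) (F : ℝ → ℝ) (θ : ℝ) : ℝ :=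
  F θ * (cos θ * bumpDeriv a b θ + sin θ * bumpDeriv2 a b θ)
    - bump a b θ * (sin (2 * F θ) / (2 * sin θ) + κ / 2 * sin θ * sin (2 * F θ - 2 * θ))

lemma continuousOn_weakForm (κ : ℝ) {a b : ℝ} (ha : 0 < a) (hb : b < π) {F : ℝ → ℝ}
    (hF : ContinuousOn F (Icc a b)) : ContinuousOn (weakForm κ a b F) (Icc a b) := by
  have h1 : ContinuousOn (bump a b) (Icc a b) := by unfold bump; fun_prop
  have h2 : ContinuousOn (bumpDeriv a b) (Icc a b) := by unfold bumpDeriv; fun_prop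
  have h3 : ContinuousOn (bumpDeriv2 a b) (Icc a b) := by unfold bumpDeriv2; fun_prop
  have hs : ∀ θ ∈ Icc a b, 2 * sin θ ≠ 0 := fun θ hθ =>
    (mul_pos two_pos (sin_pos_of_mem ⟨ha.trans_le hθ.1, hθ.2.trans_lt hb⟩)).ne'
  unfold weakForm
  fun_prop (disch := assumption)

lemma continuousOn_tension (κ : ℝ) {F : ℝ → ℝ} (hF : ContDiff ℝ 2 F) :
    ContinuousOn (tension κ F) (Ioo 0 π) := by
  have h0 := hF.continuous
  have h1 : ContDiff ℝ 1 (deriv F) := hF.deriv'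
  have h2 := h1.continuous
  have h3 := h1.continuous_deriv le_rfl
  have hs : ∀ θ ∈ Ioo 0 π, sin θ ≠ 0 := fun θ hθ => (sin_pos_of_mem hθ).ne'
  have hs2 : ∀ θ ∈ Ioo 0 π, 2 * sin θ ^ 2 ≠ 0 := fun θ hθ => by
    have := sin_pos_of_mem hθ
    positivity
  unfold tension
  fun_prop (disch := assumption)

lemma integral_bump_mul_tension (κ : ℝ) {a b : ℝ} (ha : 0 < a) (hab : a ≤ b) (hb : b < π)
    {F : ℝ → ℝ} (hF : ContDiff ℝ 2 F) :
    ∫ θ in a..b, sin θ * bump a b θ * tension κ F θ = ∫ θ in a..b, weakForm κ a b F θ := by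
  have h1 : ContDiff ℝ 1 (deriv F) := hF.deriv'
  have cF := hF.continuous
  have cF1 := h1.continuous
  have cF2 := h1.continuous_deriv le_rfl
  have dF : ∀ θ, HasDerivAt F (deriv F θ) θ := fun θ =>
    (hF.differentiable (by norm_num) θ).hasDerivAt
  have dF1 : ∀ θ, HasDerivAt (deriv F) (deriv (deriv F) θ) θ := fun θ =>
    (h1.differentiable one_ne_zero θ).hasDerivAt
  have hsub : Icc a b ⊆ Ioo 0 π := fun θ hθ => ⟨ha.trans_le hθ.1, hθ.2.trans_lt hb⟩
  have cb : Continuous (bump a b) := by unfold bump; fun_prop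
  have cb1 : Continuous (bumpDeriv a b) := by unfold bumpDeriv; fun_prop
  have cb2 : Continuous (bumpDeriv2 a b) := by unfold bumpDeriv2; fun_prop
  have ci1 := (continuousOn_weakForm κ ha hb cF.continuousOn).intervalIntegrable_of_Icc
    (μ := volume) hab
  have ct : ContinuousOn (fun θ => sin θ * bump a b θ * tension κ F θ) (Icc a b) :=
    (by fun_prop : Continuous fun θ => sin θ * bump a b θ).continuousOn.mul
      ((continuousOn_tension κ hF).mono hsub)
  have ci2 := ct.intervalIntegrable_of_Icc (μ := volume) hab
  have hW : ∀ θ, HasDerivAt (fun θ => sin θ * (bumpDeriv a b θ * F θ)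
      - sin θ * (bump a b θ * deriv F θ)) _ θ := fun θ =>
    ((hasDerivAt_sin θ).mul ((hasDerivAt_bumpDeriv a b θ).mul (dF θ))).sub
      ((hasDerivAt_sin θ).mul ((hasDerivAt_bump a b θ).mul (dF1 θ)))
  have hint := integral_eq_sub_of_hasDerivAt (a := a) (b := b) (fun θ _ => hW θ)
    (Continuous.intervalIntegrable (by simp only [Pi.mul_apply]; fun_prop) _ _)
  have hz : ∀ x, x = a ∨ x = b → bump a b x = 0 ∧ bumpDeriv a b x = 0 := by
    rintro x (rfl | rfl) <;> simp [bump, bumpDeriv]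
  rw [(hz a (Or.inl rfl)).1, (hz a (Or.inl rfl)).2, (hz b (Or.inr rfl)).1,
    (hz b (Or.inr rfl)).2] at hint
  simp only [zero_mul, mul_zero, sub_zero] at hint
  symm
  refine sub_eq_zero.1 ?_
  rw [← intervalIntegral.integral_sub ci1 ci2, ← hint]
  refine integral_congr fun θ hθ => ?_
  rw [uIcc_of_le hab] at hθ
  have hs := (sin_pos_of_mem (hsub hθ)).ne'
  simp only [weakForm, tension, Pi.mul_apply]
  field_simp
  ring

/-- The weak form depends Lipschitz continuously on the profile in `L¹`. -/
lemma exists_weakForm_lipschitz {κ : ℝ} (hκ : 0 ≤ κ) {a b : ℝ} (ha : 0 < a) (hab : a ≤ b)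
    (hb : b < π) : ∃ L, 0 ≤ L ∧ ∀ F H : ℝ → ℝ, ContinuousOn F (Icc a b) →
      ContinuousOn H (Icc a b) →
      |(∫ θ in a..b, weakForm κ a b F θ) - ∫ θ in a..b, weakForm κ a b H θ| ≤
        L * ∫ θ in a..b, |F θ - H θ| := by
  obtain ⟨m, hm, hms⟩ := exists_le_sin ha hb
  obtain ⟨C₁, hC₁⟩ := (isCompact_Icc (a := a) (b := b)).exists_bound_of_continuousOn
    (f := fun θ => cos θ * bumpDeriv a b θ + sin θ * bumpDeriv2 a b θ)
    (by unfold bumpDeriv bumpDeriv2; fun_prop)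
  obtain ⟨C₂, hC₂⟩ := (isCompact_Icc (a := a) (b := b)).exists_bound_of_continuousOn
    (f := bump a b) (by unfold bump; fun_prop)
  have hC₁0 : 0 ≤ C₁ := (norm_nonneg _).trans (hC₁ a ⟨le_rfl, hab⟩)
  have hC₂0 : 0 ≤ C₂ := (norm_nonneg _).trans (hC₂ a ⟨le_rfl, hab⟩)
  refine ⟨C₁ + C₂ * (1 / m + κ), by positivity, fun F H hF hH => ?_⟩
  have cF := continuousOn_weakForm κ ha hb hF
  have cH := continuousOn_weakForm κ ha hb hH
  rw [← intervalIntegral.integral_sub (cF.intervalIntegrable_of_Icc hab)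
    (cH.intervalIntegrable_of_Icc hab), ← intervalIntegral.integral_const_mul]
  refine (abs_integral_le_integral_abs hab).trans ?_
  refine integral_mono_on hab ((cF.sub cH).abs.intervalIntegrable_of_Icc hab)
    ((continuousOn_const.mul (hF.sub hH).abs).intervalIntegrable_of_Icc hab) fun θ hθ => ?_
  have hs := hms θ hθ
  have hs0 : 0 < sin θ := hm.trans_le hs
  have h1 := hC₁ θ hθ
  have h2 := hC₂ θ hθ
  rw [norm_eq_abs] at h1 h2
  unfold weakForm
  set w := cos θ * bumpDeriv a b θ + sin θ * bumpDeriv2 a b θ with hw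
  have e : F θ * w - bump a b θ * (sin (2 * F θ) / (2 * sin θ)
      + κ / 2 * sin θ * sin (2 * F θ - 2 * θ))
      - (H θ * w - bump a b θ * (sin (2 * H θ) / (2 * sin θ)
      + κ / 2 * sin θ * sin (2 * H θ - 2 * θ))) =
      w * (F θ - H θ) - bump a b θ * ((sin (2 * F θ) - sin (2 * H θ)) / (2 * sin θ)
        + κ / 2 * sin θ * (sin (2 * F θ - 2 * θ) - sin (2 * H θ - 2 * θ))) := by ring
  rw [e]
  have h3 : |sin (2 * F θ) - sin (2 * H θ)| ≤ 2 * |F θ - H θ| := by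
    refine (abs_sin_sub_sin_le _ _).trans_eq ?_
    rw [← mul_sub, abs_mul, abs_two]
  have h4 : |sin (2 * F θ - 2 * θ) - sin (2 * H θ - 2 * θ)| ≤ 2 * |F θ - H θ| := by
    refine (abs_sin_sub_sin_le _ _).trans_eq ?_
    rw [sub_sub_sub_cancel_right, ← mul_sub, abs_mul, abs_two]
  have h5 : |(sin (2 * F θ) - sin (2 * H θ)) / (2 * sin θ)| ≤ 1 / m * |F θ - H θ| := by
    rw [abs_div, abs_of_pos (by positivity : 0 < 2 * sin θ)]
    calc _ ≤ 2 * |F θ - H θ| / (2 * m) := by gcongr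
      _ = _ := by field_simp
  have h6 : |κ / 2 * sin θ * (sin (2 * F θ - 2 * θ) - sin (2 * H θ - 2 * θ))| ≤
      κ * |F θ - H θ| := by
    rw [abs_mul, abs_of_nonneg (by positivity : 0 ≤ κ / 2 * sin θ)]
    calc _ ≤ κ / 2 * 1 * (2 * |F θ - H θ|) := by gcongr; exact sin_le_one θ
      _ = _ := by ring
  calc _ ≤ |w * (F θ - H θ)| + |bump a b θ * ((sin (2 * F θ) - sin (2 * H θ)) / (2 * sin θ)
        + κ / 2 * sin θ * (sin (2 * F θ - 2 * θ) - sin (2 * H θ - 2 * θ)))| := abs_sub _ _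
    _ ≤ C₁ * |F θ - H θ| + C₂ * (1 / m * |F θ - H θ| + κ * |F θ - H θ|) := by
        rw [abs_mul, abs_mul]
        gcongr
        exact (abs_add_le _ _).trans (add_le_add h5 h6)
    _ = _ := by ring

/-- A continuous function on `(0, π)` orthogonal to all the test functions vanishes. -/
lemma eq_zero_of_integral_bump {f : ℝ → ℝ} (hf : ContinuousOn f (Ioo 0 π))
    (h : ∀ a b, 0 < a → a < b → b < π → ∫ θ in a..b, sin θ * bump a b θ * f θ = 0) :
    ∀ θ ∈ Ioo 0 π, f θ = 0 := by
  have key : ∀ g : ℝ → ℝ, ContinuousOn g (Ioo 0 π) →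
      (∀ a b, 0 < a → a < b → b < π → ∫ θ in a..b, sin θ * bump a b θ * g θ = 0) →
      ∀ θ ∈ Ioo 0 π, g θ ≤ 0 := by
    intro g hg hz θ hθ
    by_contra hpos
    push Not at hpos
    have hev : ∀ᶠ x in 𝓝 θ, 0 < g x ∧ x ∈ Ioo 0 π :=
      ((hg.continuousAt (Ioo_mem_nhds hθ.1 hθ.2)).eventually (lt_mem_nhds hpos)).and
        (Ioo_mem_nhds hθ.1 hθ.2)
    obtain ⟨δ, hδ, hball⟩ := Metric.eventually_nhds_iff_ball.1 hev
    have hin : ∀ x ∈ Icc (θ - δ / 2) (θ + δ / 2), 0 < g x ∧ x ∈ Ioo 0 π := fun x hx =>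
      hball x (by rw [Metric.mem_ball, Real.dist_eq, abs_lt]
                  constructor <;> linarith [hx.1, hx.2])
    have hab : θ - δ / 2 < θ + δ / 2 := by linarith
    have ha := (hin (θ - δ / 2) ⟨le_rfl, hab.le⟩).2.1
    have hb := (hin (θ + δ / 2) ⟨hab.le, le_rfl⟩).2.2
    have hpos' := intervalIntegral_pos_of_pos_on (a := θ - δ / 2) (b := θ + δ / 2)
      (f := fun x => sin x * bump (θ - δ / 2) (θ + δ / 2) x * g x)
      (ContinuousOn.intervalIntegrable_of_Icc hab.le ((by unfold bump; fun_prop : Continuous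
        fun x => sin x * bump (θ - δ / 2) (θ + δ / 2) x).continuousOn.mul
        (hg.mono fun x hx => (hin x hx).2)))
      (fun x hx => by
        have h1 := hin x (Ioo_subset_Icc_self hx)
        have h2 := sin_pos_of_mem h1.2
        have h3 : 0 < bump (θ - δ / 2) (θ + δ / 2) x :=
          mul_pos (pow_pos (by linarith [hx.1]) 2) (pow_pos (by linarith [hx.2]) 2)
        exact mul_pos (mul_pos h2 h3) h1.1) hab
    rw [hz _ _ ha hab hb] at hpos'
    exact lt_irrefl _ hpos'
  intro θ hθ
  have h1 := key f hf h θ hθ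
  have h2 := key (fun x => -f x) hf.neg (fun a b ha hab hb => by
    simp only [mul_neg, intervalIntegral.integral_neg, h a b ha hab hb, neg_zero]) θ hθ
  linarith

/-! ### Limits of the flow are stationary -/

/-- A sequential limit of the flow as `t → ∞` solves the stationary equation. -/
lemma IsProfileFlow.tension_limit_eq_zero {κ : ℝ} {u : ℝ → ℝ → ℝ}
    (hu : IsProfileFlow κ (initialProfile κ) u) (hκ : 4 ≤ κ) {τ : ℕ → ℝ}
    (hτ : Tendsto τ atTop atTop) {H : ℝ → ℝ} (hH : ContDiff ℝ 2 H)
    (hlim : TendstoUniformlyOn (fun j => u (τ j)) H atTop (Icc 0 π)) :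
    ∀ θ ∈ Ioo 0 π, tension κ H θ = 0 := by
  refine eq_zero_of_integral_bump (continuousOn_tension κ hH) fun a b ha hab hb => ?_
  rw [integral_bump_mul_tension κ ha hab.le hb hH]
  obtain ⟨L, hL0, hL⟩ := exists_weakForm_lipschitz (by linarith : 0 ≤ κ) ha hab.le hb
  obtain ⟨C, hC⟩ := (isCompact_Icc (a := a) (b := b)).exists_bound_of_continuousOn
    (f := fun θ => sin θ * bump a b θ) (by unfold bump; fun_prop)
  have hsub : Icc a b ⊆ Icc 0 π := Icc_subset_Icc ha.le hb.le
  have hC0 : 0 ≤ C := (norm_nonneg _).trans (hC a ⟨le_rfl, hab.le⟩)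
  have hA := (hu.tendsto_integral_abs_timeDeriv hκ ha hab hb).comp hτ
  set A : ℝ → ℝ := fun τ => ∫ t in τ..(τ + 1), ∫ θ in a..b, |timeDeriv u (t, θ)| with hAdef
  have hba : 0 < b - a := by linarith
  have hbound : ∀ ε > 0, |∫ θ in a..b, weakForm κ a b H θ| ≤
      C * ε + L * (ε + ε * (b - a)) := by
    intro ε hε
    have ev1 := (tendsto_order.1 hA).2 ε hε
    have ev2 := Metric.tendstoUniformlyOn_iff.1 hlim ε hε
    obtain ⟨j, hj1, hj2, hj3⟩ := (ev1.and (ev2.and (hτ.eventually_ge_atTop 1))).exists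
    obtain ⟨t, ht, ht1, ht2⟩ := hu.exists_good_time ha hab hb hj3
    change A (τ j) < ε at hj1
    have ht0 : 0 < t := by linarith [ht.1]
    obtain ⟨V, hV, hVu⟩ := hu.exists_extension ht0
    have hcu : ∀ s, 0 < s → ContinuousOn (u s) (Icc a b) := fun s hs =>
      hu.continuousOn.comp (f := fun x : ℝ => (s, x)) (by fun_prop)
        fun x hx => ⟨hs.le, hsub hx⟩
    have hV1 : |∫ θ in a..b, weakForm κ a b V θ| ≤ C * ε := by
      rw [← integral_bump_mul_tension κ ha hab.le hb hV]
      have hct : ContinuousOn (fun θ => timeDeriv u (t, θ)) (Icc a b) :=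
        continuousOn_slice (a := t) (b := t) ⟨le_rfl, le_rfl⟩ (hu.continuousOn_timeDeriv ht0 ha hb)
      have heq : ∫ θ in a..b, sin θ * bump a b θ * tension κ V θ =
          ∫ θ in a..b, sin θ * bump a b θ * timeDeriv u (t, θ) := by
        refine integral_congr fun θ hθ => ?_
        rw [uIcc_of_le hab.le] at hθ
        have hθ' : θ ∈ Ioo 0 π := ⟨ha.trans_le hθ.1, hθ.2.trans_lt hb⟩
        have h1 : V =ᶠ[𝓝 θ] u t := hVu.eventuallyEq_of_mem (Icc_mem_nhds hθ'.1 hθ'.2)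
        simp only [hu.timeDeriv_eq_tension ht0 hθ', tension, h1.deriv_eq, h1.deriv.deriv_eq,
          h1.eq_of_nhds]
      rw [heq]
      have cb : Continuous fun θ => sin θ * bump a b θ := by unfold bump; fun_prop
      have h2 : ∫ θ in a..b, |sin θ * bump a b θ * timeDeriv u (t, θ)| ≤
          ∫ θ in a..b, C * |timeDeriv u (t, θ)| := by
        refine integral_mono_on hab.le
          ((cb.continuousOn.mul hct).abs.intervalIntegrable_of_Icc hab.le)
          ((continuousOn_const.mul hct.abs).intervalIntegrable_of_Icc hab.le) fun θ hθ => ?_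
        rw [abs_mul]
        gcongr
        exact hC θ hθ
      rw [intervalIntegral.integral_const_mul] at h2
      refine (abs_integral_le_integral_abs hab.le).trans (h2.trans ?_)
      gcongr
      exact ht1.trans hj1.le
    have hd : ∫ θ in a..b, |V θ - H θ| ≤ ε + ε * (b - a) := by
      have cτ := hcu (τ j) (by linarith)
      have cH := hH.continuous.continuousOn (s := Icc a b)
      have cV := hV.continuous.continuousOn (s := Icc a b)
      have h1 : ∫ θ in a..b, |V θ - H θ| ≤ ∫ θ in a..b, (|u t θ - u (τ j) θ| + ε) := by
        refine integral_mono_on hab.le ((cV.sub cH).abs.intervalIntegrable_of_Icc hab.le)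
          ((((hcu t ht0).sub cτ).abs.add continuousOn_const).intervalIntegrable_of_Icc hab.le)
          fun θ hθ => ?_
        rw [hVu (hsub hθ)]
        have h2 := hj2 θ (hsub hθ)
        rw [Real.dist_eq, abs_sub_comm] at h2
        exact (abs_sub_le _ (u (τ j) θ) _).trans (by linarith)
      have h2 : IntervalIntegrable (fun θ => |u t θ - u (τ j) θ|) volume a b :=
        ((hcu t ht0).sub cτ).abs.intervalIntegrable_of_Icc hab.le
      rw [intervalIntegral.integral_add h2 intervalIntegrable_const,
        intervalIntegral.integral_const, smul_eq_mul] at h1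
      linarith [ht2, hj1]
    have h3 := hL V H hV.continuous.continuousOn hH.continuous.continuousOn
    have h4 : L * ∫ θ in a..b, |V θ - H θ| ≤ L * (ε + ε * (b - a)) := by gcongr
    have h5 := abs_sub_abs_le_abs_sub (∫ θ in a..b, weakForm κ a b H θ)
      (∫ θ in a..b, weakForm κ a b V θ)
    rw [abs_sub_comm] at h5
    linarith
  have hl : Tendsto (fun ε : ℝ => C * ε + L * (ε + ε * (b - a))) (𝓝[>] 0) (𝓝 0) := by
    have hc : Continuous fun ε : ℝ => C * ε + L * (ε + ε * (b - a)) := by fun_prop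
    simpa using (hc.tendsto 0).mono_left (nhdsWithin_le_nhds (s := Ioi 0))
  have h0 : |∫ θ in a..b, weakForm κ a b H θ| ≤ 0 := by
    refine ge_of_tendsto hl ?_
    filter_upwards [self_mem_nhdsWithin] with ε hε using hbound ε hε
  exact abs_nonpos_iff.1 h0

/-! ### Profiles of first type -/

/-- A profile of first type inherits from the flow the stationary equation, the symmetry about the
equator and the bounds on the northern hemisphere. -/
lemma IsFirstTypeProfile.secondVariation_neg {κ : ℝ} (hκ : 1000 ^ 2 ≤ κ) {h : ℝ → ℝ}
    (hf : IsFirstTypeProfile κ h) : secondVariation κ h (shiftDirection h) < 0 := by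
  obtain ⟨hh, u, hu, τ, hτ, hlim⟩ := hf
  have hκ4 : 4 ≤ κ := by linarith
  have hr : 1000 ≤ √κ := le_sqrt_of_sq_le hκ
  obtain ⟨H, hH, hHh⟩ := exists_contDiff_extension pi_pos 3
    (hh.of_le (by norm_cast : ((3 : ℕ) : WithTop ℕ∞) ≤ ∞))
  replace hH : ContDiff ℝ 3 H := hH
  have hlimH : TendstoUniformlyOn (fun j => u (τ j)) H atTop (Icc 0 π) :=
    hlim.congr_right hHh.symm
  have hpt : ∀ θ ∈ Icc 0 π, Tendsto (fun j => u (τ j) θ) atTop (𝓝 (H θ)) := fun θ hθ =>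
    hlimH.tendsto_at hθ
  have hev : ∀ᶠ j in atTop, 0 ≤ τ j := hτ.eventually_ge_atTop 0
  have hle : π / 2 ≤ π := by linarith [pi_pos]
  have hsym : ∀ θ ∈ Icc 0 π, H θ + H (π - θ) = 2 * π := fun θ hθ => by
    have h1 := (hpt θ hθ).add (hpt (π - θ) ⟨by linarith [hθ.2], by linarith [hθ.1]⟩)
    refine tendsto_nhds_unique h1 (tendsto_const_nhds.congr' ?_)
    filter_upwards [hev] with j hj using (hu.add_reflect hκ4 hj hθ).symm
  have hmem : ∀ θ ∈ Icc 0 (π / 2), H θ ∈ Icc π (π + θ) := fun θ hθ => by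
    refine isClosed_Icc.mem_of_tendsto (hpt θ ⟨hθ.1, hθ.2.trans hle⟩) ?_
    filter_upwards [hev] with j hj using hu.mem_hemisphere hκ4 hj hθ
  have hst := hu.tension_limit_eq_zero hκ4 hτ (hH.of_le (by norm_num)) hlimH
  have hmid : H (π / 2) = π := by
    have := hsym (π / 2) ⟨by positivity, hle⟩
    rw [show π - π / 2 = π / 2 by ring] at this
    linarith
  have h0 : H 0 = π := by
    have := hmem 0 ⟨le_rfl, by positivity⟩
    exact le_antisymm (by simpa using this.2) this.1
  have hπ : H π = π := by
    have := hsym 0 ⟨le_rfl, pi_pos.le⟩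
    rw [sub_zero, h0] at this
    linarith
  have hhemi : IsHemisphereProfile κ H := ⟨hH.of_le (by norm_num), hst, fun θ hθ => (hmem θ hθ).1,
    fun θ hθ => (hmem θ hθ).2, hmid⟩
  rw [secondVariation_congr κ (h₂ := H) fun θ hθ => (hHh (Ioo_subset_Icc_self hθ)).symm,
    secondVariation_eq_integral_shiftDensity κ hH h0 hπ hst,
    integral_shiftDensity_eq_two_mul κ (hH.of_le (by norm_num)) hsym]
  linarith [hhemi.integral_shiftDensity_neg hr]

end SkyrmionSphere

theorem mainTheorem6 :
    ∃ κ₀ : ℝ, 4 ≤ κ₀ ∧ ∀ κ : ℝ, κ₀ ≤ κ → ∀ h : ℝ → ℝ,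
      SkyrmionSphere.IsFirstTypeProfile κ h →
        SkyrmionSphere.secondVariation κ h (SkyrmionSphere.shiftDirection h) < 0 :=
  ⟨1000 ^ 2, by norm_num, fun _ hκ _ hf => hf.secondVariation_neg hκ⟩
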